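/- Let $\epsilon>0$ and let $v_1,\dots,v_m$ be jointly independent random vectors in $\mathbb{C}^d$, defined on a common probability space, each taking only finitely many values, such that $$\sum_{i=1}^m \mathbb{E}[v_i v_i^*] = \mathbf{I} \qquad\text{and}\qquad \mathbb{E}\,\|v_i\|^2 \le \epsilon \quad\text{for all } i=1,\dots,m,$$ where $\mathbf I$ is the $d\times d$ identity matrix and $\|v\|$ is the Euclidean norm. Then, with $\|\cdot\|$ denoting the operator norm of a $d\times d$ matrix induced by the Euclidean norm, $$\mathbb{P}\Big(\Big\|\sum_{i=1}^m v_i v_i^*\Big\| \le (1+\sqrt{\epsilon})^2\Big) > 0.$$ If, moreover, each $v_i$ takes at most two values and $\epsilon<1/4$, then $$\mathbb{P}\Big(\Big\|\sum_{i=1}^m v_i v_i^*\Big\| \le 1+2\sqrt{\epsilon}\,\sqrt{1-\epsilon}\Big) > 0.$$ -/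

import Mathlib

open MeasureTheory ProbabilityTheory

/- The norm on square complex matrices is the operator norm induced by the Euclidean norm. -/
open scoped Matrix.Norms.L2Operator

/-- The matrix `v v*` of a vector `v ∈ ℂ^d`; its `(j, k)` entry is `v j * conj (v k)`. -/
def selfOuter {d : ℕ} (v : EuclideanSpace ℂ (Fin d)) : Matrix (Fin d) (Fin d) ℂ :=
  Matrix.vecMulVec v.ofLp (star v.ofLp)

/-! Give each pair $k=(i,j)$, with $w_{ij}$ the $j$-th value of $v_i$ and $q_{ij}$ its probability,
a variable $z_k$, and let $p(z)=\det\sum_k z_k w_k w_k^*$. This polynomial is real stable and affine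
in each variable, and $p(xe)=x^d$ at $e=(q_{ij})$. For a direction $a$ consider $1-D_a$. On a
coordinate direction it is translation by $-a$, so the product of these operators over a choice of
values, evaluated at $xe$, is $\det(x-\sum_i v_iv_i^*)$ for that choice. Since $D_a$ is linear in
$a$, the averaged directions $a_i=\sum_j q_{ij}b_{ij}$ give the expected characteristic polynomial.

Interlacing (`exists_choice_pos_on_ray`): if the averaged polynomial is positive on $\{xe : x\ge
B\}$, then the averages can be replaced one at a time by values of positive probability, keeping
positivity. The chosen sum then has norm at most $B$ (`norm_le_of_det_ne_zero`).

Barrier (`AboveZeros.subDirDerivs`): at $te$ the barrier $D_{a_i}p/p$ equals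
$\mathbb{E}\|v_i\|^2/t\le\epsilon/t$. Applying $1-D_{a_i}$ and moving by $\delta a_i$ keeps the
point above the zeros and raises no barrier. As $\sum_i a_i=e$, this ends at $(t+\delta)e$, and $t$
and $\delta$ are then optimised. With two values, $p$ is at most quadratic along $a_i$, which
permits a smaller $\delta$.

Both halves rest on one fact: along nonnegative directions $D_bp/p$ maps the upper half-plane to the
closed lower one, so it is decreasing and has partial fractions with nonnegative residues. -/

/-! ### Rational functions mapping the upper half-plane to the lower one, and the shift inequality.
-/

section Univariate

open Polynomial Filter Topology
open scoped ComplexConjugate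

/-- On the open upper half-plane the rational function `R / P` takes values in the closed lower
half-plane (in a form that also makes sense at the zeros of `P`). -/
def LowerPair (P R : ℝ[X]) : Prop :=
  ∀ s : ℂ, 0 < s.im → (aeval s R * conj (aeval s P)).im ≤ 0

theorem aeval_ofReal_eq (P : ℝ[X]) (x : ℝ) : aeval (x : ℂ) P = ((P.eval x : ℝ) : ℂ) := by
  rw [← Complex.coe_algebraMap, aeval_algebraMap_apply_eq_algebraMap_eval]

theorem hasDerivAt_aeval_vertical (P : ℝ[X]) (x y : ℝ) :
    HasDerivAt (fun t : ℝ => aeval ((x : ℂ) + t * Complex.I) P)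
      (aeval ((x : ℂ) + y * Complex.I) (derivative P) * Complex.I) y := by
  have h1 : HasDerivAt (fun t : ℝ => (x : ℂ) + t * Complex.I) Complex.I y := by
    simpa using ((Complex.ofRealCLM.hasDerivAt (x := y)).mul_const Complex.I).const_add (x : ℂ)
  have h2 := P.hasDerivAt_aeval ((x : ℂ) + y * Complex.I)
  exact h2.comp (𝕜 := ℝ) y h1

/-- The derivative of `R / P` is nonpositive on the real line. -/
theorem LowerPair.wronskian_nonpos {P R : ℝ[X]} (h : LowerPair P R) (x : ℝ) :
    (derivative R).eval x * P.eval x - R.eval x * (derivative P).eval x ≤ 0 := by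
  have hR := hasDerivAt_aeval_vertical R x 0
  have hP := hasDerivAt_aeval_vertical P x 0
  have hd := ((Complex.imCLM.hasFDerivAt.comp_hasDerivAt 0 hR).mul
    (Complex.reCLM.hasFDerivAt.comp_hasDerivAt 0 hP)).sub
    ((Complex.reCLM.hasFDerivAt.comp_hasDerivAt 0 hR).mul
    (Complex.imCLM.hasFDerivAt.comp_hasDerivAt 0 hP))
  have hlim := hd.tendsto_slope_zero_right
  have hle := le_of_tendsto (b := 0) hlim (by
    filter_upwards [self_mem_nhdsWithin] with t ht
    have ht' : 0 < t := ht
    have := h ((x : ℂ) + t * Complex.I) (by simpa using ht')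
    rw [Complex.mul_im, Complex.conj_re, Complex.conj_im] at this
    refine mul_nonpos_of_nonneg_of_nonpos (inv_nonneg.2 ht'.le) ?_
    simp [aeval_ofReal_eq]
    linarith)
  simpa [aeval_ofReal_eq] using hle

/-- On a vertical line $\frac{d}{dy}|P|^2=-2\,\mathrm{Im}(P'\overline P)\ge 0$. A zero in the upper
half-plane would thus force zeros on the whole segment below it, down to the real axis; conjugation
handles the lower half-plane. -/
theorem LowerPair.splits {P : ℝ[X]} (hP : P ≠ 0) (h : LowerPair P (derivative P)) :
    P.Splits := by
  refine Splits.of_splits_map (algebraMap ℝ ℂ) (IsAlgClosed.splits _) fun a ha => ?_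
  have key : ∀ s : ℂ, 0 < s.im → aeval s P ≠ 0 := by
    intro s hs h0
    have hd : ∀ y : ℝ, HasDerivAt (fun t : ℝ => Complex.normSq (aeval ((s.re : ℂ) + t * Complex.I) P))
        (-2 * (aeval ((s.re : ℂ) + y * Complex.I) (derivative P) *
          conj (aeval ((s.re : ℂ) + y * Complex.I) P)).im) y := by
      intro y
      have h1 := hasDerivAt_aeval_vertical P s.re y
      have hre := (Complex.reCLM.hasFDerivAt.comp_hasDerivAt y h1)
      have him := (Complex.imCLM.hasFDerivAt.comp_hasDerivAt y h1)
      have := (hre.mul hre).add (him.mul him)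
      refine (this.congr_deriv ?_)
      simp
      ring
    have hmono : MonotoneOn (fun t : ℝ => Complex.normSq (aeval ((s.re : ℂ) + t * Complex.I) P))
        (Set.Ioi 0) := by
      refine monotoneOn_of_deriv_nonneg (convex_Ioi 0)
        (fun y _ => (hd y).continuousAt.continuousWithinAt)
        (fun y _ => (hd y).differentiableAt.differentiableWithinAt) fun y hy => ?_
      rw [interior_Ioi] at hy
      rw [(hd y).deriv]
      have := h ((s.re : ℂ) + y * Complex.I) (by simpa using hy)
      linarith
    have hz : ∀ y ∈ Set.Ioc 0 s.im, aeval ((s.re : ℂ) + y * Complex.I) P = 0 := by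
      intro y hy
      have := hmono hy.1 hs hy.2
      simp only [Complex.re_add_im, h0, map_zero] at this
      exact Complex.normSq_eq_zero.1 (le_antisymm this (Complex.normSq_nonneg _))
    have hinj : Function.Injective (fun y : ℝ => (s.re : ℂ) + y * Complex.I) := by
      intro y y' hyy
      simpa using hyy
    refine hP ((Polynomial.map_eq_zero (algebraMap ℝ ℂ)).1
      (Polynomial.eq_zero_of_infinite_isRoot _
        (((Set.Ioc_infinite hs).image hinj.injOn).mono ?_)))
    rintro _ ⟨y, hy, rfl⟩
    simpa [IsRoot, eval_map_algebraMap] using hz y hy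
  have ha' : aeval a P = 0 := by
    simpa [eval_map_algebraMap, hP] using ha
  rcases lt_trichotomy a.im 0 with hl | he | hg
  · refine absurd ?_ (key (conj a) (by simpa using hl))
    rw [aeval_conj, ha', map_zero]
  · exact ⟨a.re, Complex.ext (by simp) (by simp [he])⟩
  · exact absurd ha' (key a hg)

theorem LowerPair.antitoneOn_div {P R : ℝ[X]} {D : Set ℝ} (hD : Convex ℝ D)
    (h : LowerPair P R) (hpos : ∀ s ∈ D, 0 < P.eval s) :
    AntitoneOn (fun s => R.eval s / P.eval s) D := by
  refine antitoneOn_of_deriv_nonpos hD ?_ ?_ ?_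
  · exact R.continuousOn.div P.continuousOn fun s hs => (hpos s hs).ne'
  · exact fun s hs => ((R.differentiableAt).div P.differentiableAt
      (hpos s (interior_subset hs)).ne').differentiableWithinAt
  · intro s hs
    have h1 := (R.hasDerivAt s).div (P.hasDerivAt s) (hpos s (interior_subset hs)).ne'
    have h2 : deriv (fun s => R.eval s / P.eval s) s = _ := h1.deriv
    rw [h2]
    exact div_nonpos_of_nonpos_of_nonneg (h.wronskian_nonpos s) (sq_nonneg _)

/-- A zero of `P` that is not a zero of `R` is simple. -/
theorem LowerPair.rootMultiplicity_le_one {P R : ℝ[X]} (hP : P ≠ 0) (h : LowerPair P R) {a : ℝ}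
    (hR : R.eval a ≠ 0) : P.rootMultiplicity a ≤ 1 := by
  by_contra! hm
  set m := P.rootMultiplicity a with hm_def
  obtain ⟨Q, hPQ, hQ⟩ := P.exists_eq_pow_rootMultiplicity_mul_and_not_dvd hP a
  rw [← hm_def] at hPQ
  have hQa : Q.eval a ≠ 0 := by rwa [dvd_iff_isRoot] at hQ
  -- Leading behaviour of $R\overline P$ at $a+r\omega$ as $r\to0^+$. When $m\ge2$, $\omega^m$ can
  -- be both $i$ and $-i$, which forces $R(a)Q(a)=0$.
  have key : ∀ ω : ℂ, 0 < ω.im → ((R.eval a * Q.eval a : ℝ) * conj (ω ^ m)).im ≤ 0 := by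
    intro ω hω
    have hc : Continuous fun r : ℝ => (aeval ((a : ℂ) + r * ω) R *
        conj (aeval ((a : ℂ) + r * ω) Q) * conj (ω ^ m)).im := by
      have h1 : ∀ S : ℝ[X], Continuous fun r : ℝ => aeval ((a : ℂ) + r * ω) S := fun S =>
        (Polynomial.continuous_aeval S).comp (by fun_prop)
      exact Complex.continuous_im.comp
        (((h1 R).mul (Complex.continuous_conj.comp (h1 Q))).mul continuous_const)
    have hlim : Tendsto (fun r : ℝ => (aeval ((a : ℂ) + r * ω) R *
        conj (aeval ((a : ℂ) + r * ω) Q) * conj (ω ^ m)).im) (𝓝[>] 0)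
        (𝓝 ((R.eval a * Q.eval a : ℝ) * conj (ω ^ m)).im) := by
      have := (hc.tendsto 0).mono_left (nhdsWithin_le_nhds (s := Set.Ioi 0))
      simpa only [Complex.ofReal_zero, zero_mul, add_zero, aeval_ofReal_eq, Complex.conj_ofReal,
        ← Complex.ofReal_mul] using this
    refine le_of_tendsto hlim ?_
    filter_upwards [self_mem_nhdsWithin] with r hr
    have hr' : 0 < r := hr
    have h2 := h ((a : ℂ) + r * ω) (by simpa using mul_pos hr' hω)
    have h3 : aeval ((a : ℂ) + r * ω) R * conj (aeval ((a : ℂ) + r * ω) P) =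
        ((r ^ m : ℝ) : ℂ) * (aeval ((a : ℂ) + r * ω) R *
        conj (aeval ((a : ℂ) + r * ω) Q) * conj (ω ^ m)) := by
      rw [hPQ]
      simp [mul_pow]
      ring
    rw [h3, Complex.im_ofReal_mul] at h2
    exact nonpos_of_mul_nonpos_right h2 (pow_pos hr' m)
  have hexp : ∀ θ : ℝ, (Complex.exp (θ / m * Complex.I)) ^ m = Complex.exp (θ * Complex.I) := by
    intro θ
    rw [← Complex.exp_nat_mul]
    congr 1
    have : (m : ℂ) ≠ 0 := by exact_mod_cast (by omega : m ≠ 0)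
    field_simp
  have him : ∀ θ : ℝ, 0 < θ → θ < m * Real.pi → 0 < (Complex.exp (θ / m * Complex.I)).im := by
    intro θ h0 h1
    have hm0 : (0 : ℝ) < m := by exact_mod_cast (by omega : 0 < m)
    have : ((θ : ℂ) / m) = ((θ / m : ℝ) : ℂ) := by push_cast; rfl
    rw [this, Complex.exp_ofReal_mul_I_im]
    exact Real.sin_pos_of_pos_of_lt_pi (by positivity) (by rwa [div_lt_iff₀ hm0, mul_comm])
  have hm2 : (2 : ℝ) ≤ m := by exact_mod_cast hm
  have h1 := key _ (him (Real.pi / 2) (by positivity) (by nlinarith [Real.pi_pos]))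
  have h2 := key _ (him (3 * Real.pi / 2) (by positivity) (by nlinarith [Real.pi_pos]))
  rw [hexp] at h1 h2
  have hne := mul_ne_zero hR hQa
  have e1 : Complex.exp (((Real.pi / 2 : ℝ) : ℂ) * Complex.I) = Complex.I := by
    push_cast; exact Complex.exp_pi_div_two_mul_I
  have e2 : Complex.exp (((3 * Real.pi / 2 : ℝ) : ℂ) * Complex.I) = -Complex.I := by
    rw [show (((3 * Real.pi / 2 : ℝ) : ℂ) * Complex.I) =
      Real.pi * Complex.I + Real.pi / 2 * Complex.I by push_cast; ring, Complex.exp_add,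
      Complex.exp_pi_mul_I, Complex.exp_pi_div_two_mul_I, neg_one_mul]
  rw [e1] at h1
  rw [e2] at h2
  simp at h1 h2
  exact hne (le_antisymm (by linarith) (by linarith))

theorem LowerPair.of_mul_X_sub_C {P R : ℝ[X]} {a : ℝ}
    (h : LowerPair ((X - C a) * P) ((X - C a) * R)) : LowerPair P R := by
  intro s hs
  have h1 := h s hs
  have hne : s - a ≠ 0 := by
    intro h0
    have := congrArg Complex.im h0
    simp at this
    exact hs.ne' this
  have h2 : aeval s ((X - C a) * R) * conj (aeval s ((X - C a) * P)) =
      ((Complex.normSq (s - a) : ℝ) : ℂ) * (aeval s R * conj (aeval s P)) := by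
    rw [Complex.normSq_eq_conj_mul_self]
    simp
    ring
  rw [h2, Complex.im_ofReal_mul] at h1
  exact nonpos_of_mul_nonpos_right h1 (Complex.normSq_pos.2 hne)

/-- $R/P$ is nonnegative and decreasing on $[0,\infty)$, hence bounded there. -/
theorem LowerPair.degree_le {P R : ℝ[X]} (h : LowerPair P R)
    (hpos : ∀ s, 0 ≤ s → 0 < P.eval s) (hnn : ∀ s, 0 ≤ s → 0 ≤ R.eval s) :
    R.degree ≤ P.degree := by
  by_contra! hlt
  have hP : P ≠ 0 := fun h0 => by simpa [h0] using hpos 0 le_rfl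
  have ht := Polynomial.abs_div_tendsto_atTop_atTop_of_degree_gt R P hlt hP
  have hanti := LowerPair.antitoneOn_div (convex_Ici 0) h hpos
  obtain ⟨s, hs, hs0⟩ := ((ht.eventually_gt_atTop (R.eval 0 / P.eval 0)).and
    (eventually_ge_atTop 0)).exists
  rw [abs_of_nonneg (div_nonneg (hnn s hs0) (hpos s hs0).le)] at hs
  exact absurd (hanti (Set.mem_Ici.2 le_rfl) (Set.mem_Ici.2 hs0) hs0) (not_le.2 hs)

theorem LowerPair.partialFractions_of_disjoint_roots {P R : ℝ[X]} (h : LowerPair P R)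
    (hsplit : P.Splits) (hpos : ∀ s, 0 ≤ s → 0 < P.eval s) (hnn : ∀ s, 0 ≤ s → 0 ≤ R.eval s)
    (hdisj : ∀ a ∈ P.roots, R.eval a ≠ 0) :
    ∃ (c : ℝ) (α : ℝ → ℝ), (∀ a ∈ P.roots.toFinset, 0 ≤ α a) ∧
      ∀ s, 0 ≤ s → R.eval s / P.eval s = c + ∑ a ∈ P.roots.toFinset, α a / (s - a) := by
  have hP : P ≠ 0 := fun h0 => by simpa [h0] using hpos 0 le_rfl
  have hnodup : P.roots.Nodup := by
    rw [Multiset.nodup_iff_count_le_one]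
    intro a
    by_cases ha : a ∈ P.roots
    · rw [count_roots]
      exact h.rootMultiplicity_le_one hP (hdisj a ha)
    · simp [Multiset.count_eq_zero_of_notMem ha]
  set S := P.roots.toFinset with hS
  set l := P.leadingCoeff with hl
  have hl0 : l ≠ 0 := leadingCoeff_ne_zero.2 hP
  have hSval : S.val = P.roots := by rw [hS, Multiset.toFinset_val, hnodup.dedup]
  have hfac : P = C l * Lagrange.nodal S id := by
    conv_lhs => rw [hsplit.eq_prod_roots]
    rw [Lagrange.nodal, Finset.prod, hSval]
    rfl
  have hcard : P.degree = S.card := by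
    rw [degree_eq_natDegree hP, hsplit.natDegree_eq_card_roots, ← hSval]
    rfl
  -- The value of $R/P$ at infinity. Subtracting $cP$ brings the degree below the number of roots,
  -- so Lagrange interpolation at the roots is exact.
  set c := R.coeff P.natDegree / l with hc
  have hdeg : (R - C c * P).degree < S.card := by
    rw [← hcard, degree_eq_natDegree hP, degree_lt_iff_coeff_zero]
    intro k hk
    rw [coeff_sub, coeff_C_mul]
    rcases hk.eq_or_lt with rfl | hk
    · rw [hc, coeff_natDegree, div_mul_cancel₀ _ hl0, sub_self]
    · have hRP := h.degree_le hpos hnn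
      have hk' : P.degree < k := by
        rw [degree_eq_natDegree hP]
        exact_mod_cast hk
      rw [coeff_eq_zero_of_degree_lt hk', coeff_eq_zero_of_degree_lt (hRP.trans_lt hk'), mul_zero,
        sub_zero]
  have hint := Lagrange.eq_interpolate (v := id) (Set.injOn_id _) hdeg
  refine ⟨c, fun a => R.eval a * Lagrange.nodalWeight S id a / l, fun a ha => ?_, fun s hs => ?_⟩
  · have hra : P.eval a = 0 := (mem_roots'.1 (Multiset.mem_toFinset.1 ha)).2
    have hw := h.wronskian_nonpos a
    rw [hra, mul_zero, zero_sub, neg_nonpos] at hw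
    have hd : (derivative P).eval a = l * (derivative (Lagrange.nodal S id)).eval a := by
      conv_lhs => rw [hfac]
      simp
    rw [hd] at hw
    simp only [Lagrange.nodalWeight_eq_eval_derivative_nodal ha, id]
    set D := (derivative (Lagrange.nodal S id)).eval a
    -- The residue $R(a)/P'(a)$ has the sign of $R(a)P'(a)$, which the Wronskian inequality at $a$
    -- makes nonnegative.
    have : R.eval a * D⁻¹ / l = (R.eval a * (l * D)) * (D⁻¹ / l) ^ 2 := by
      by_cases hD : D = 0
      · simp [hD]
      · field_simp
    rw [this]
    positivity
  · have hne : ∀ a ∈ S, s ≠ id a := by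
      rintro a ha rfl
      exact (hpos _ hs).ne' (mem_roots'.1 (Multiset.mem_toFinset.1 ha)).2
    have h1 := Lagrange.eval_interpolate_not_at_node
      (fun i => (R - C c * P).eval (id i)) hne
    rw [← hint] at h1
    have h2 : P.eval s = l * (Lagrange.nodal S id).eval s := by
      conv_lhs => rw [hfac]
      simp
    have hps := (hpos s hs).ne'
    rw [eval_sub, eval_mul, eval_C] at h1
    rw [div_eq_iff hps, add_mul, ← sub_eq_iff_eq_add', h1, h2, Finset.mul_sum, Finset.sum_mul]
    refine Finset.sum_congr rfl fun a ha => ?_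
    have hra : P.eval a = 0 := (mem_roots'.1 (Multiset.mem_toFinset.1 ha)).2
    simp only [id, eval_sub, eval_mul, eval_C, hra, mul_zero, sub_zero]
    have : s - a ≠ 0 := sub_ne_zero.2 (hne a ha)
    field_simp

/-- Partial fraction expansion, with nonnegative residues, of a rational function that maps the
upper half-plane to the lower one and is nonnegative, without poles, on `[0, ∞)`. -/
theorem LowerPair.partialFractions {P R : ℝ[X]} (h : LowerPair P R)
    (hsplit : P.Splits) (hpos : ∀ s, 0 ≤ s → 0 < P.eval s) (hnn : ∀ s, 0 ≤ s → 0 ≤ R.eval s) :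
    ∃ (c : ℝ) (S : Finset ℝ) (α : ℝ → ℝ), (∀ a ∈ S, a ∈ P.roots) ∧ (∀ a ∈ S, 0 ≤ α a) ∧
      ∀ s, 0 ≤ s → R.eval s / P.eval s = c + ∑ a ∈ S, α a / (s - a) := by
  induction hn : P.natDegree generalizing P R with
  | zero =>
    obtain ⟨c, α, h1, h2⟩ := h.partialFractions_of_disjoint_roots hsplit hpos hnn (by
      intro a ha
      have := card_roots' P
      rw [hn, Nat.le_zero, Multiset.card_eq_zero] at this
      simp [this] at ha)
    exact ⟨c, _, α, fun a ha => Multiset.mem_toFinset.1 ha, h1, h2⟩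
  | succ n ih =>
    by_cases hdisj : ∀ a ∈ P.roots, R.eval a ≠ 0
    · obtain ⟨c, α, h1, h2⟩ := h.partialFractions_of_disjoint_roots hsplit hpos hnn hdisj
      exact ⟨c, _, α, fun a ha => Multiset.mem_toFinset.1 ha, h1, h2⟩
    -- A common root is cancelled from both polynomials; this divides $R\overline P$ by $|s-a|^2$
    -- and so preserves `LowerPair`.
    push Not at hdisj
    obtain ⟨a, ha, hRa⟩ := hdisj
    obtain ⟨P₁, rfl⟩ := dvd_iff_isRoot.2 (mem_roots'.1 ha).2
    obtain ⟨R₁, rfl⟩ := dvd_iff_isRoot.2 hRa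
    have hne := (mem_roots'.1 ha).1
    have ha0 : a < 0 := by
      by_contra! h0
      simpa using hpos a h0
    have hsa : ∀ s, 0 ≤ s → 0 < s - a := fun s hs => by linarith
    obtain ⟨c, S, α, h1, h2, h3⟩ := ih h.of_mul_X_sub_C
      (hsplit.of_dvd hne (dvd_mul_left _ _))
      (fun s hs => by
        have := hpos s hs
        simp only [eval_mul, eval_sub, eval_X, eval_C] at this
        exact (pos_iff_pos_of_mul_pos this).1 (hsa s hs))
      (fun s hs => by
        have := hnn s hs
        simp only [eval_mul, eval_sub, eval_X, eval_C] at this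
        exact nonneg_of_mul_nonneg_right this (hsa s hs))
      (by
        rw [natDegree_mul (X_sub_C_ne_zero a) (right_ne_zero_of_mul hne), natDegree_X_sub_C] at hn
        omega)
    refine ⟨c, S, α, fun b hb => ?_, h2, fun s hs => ?_⟩
    · rw [roots_mul hne]
      exact Multiset.mem_add.2 (Or.inr (h1 b hb))
    · rw [← h3 s hs]
      simp only [eval_mul, eval_sub, eval_X, eval_C]
      rw [mul_div_mul_left _ _ (hsa s hs).ne']

/-- The condition under which the shift by `δ` compensates for passing from a polynomial
`P` to its difference with its derivative. -/
def ShiftCondition (P : ℝ[X]) (δ : ℝ) : Prop :=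
  (derivative P).eval δ < P.eval δ ∧
    ∀ a ∈ P.roots, 1 ≤ δ * (1 + δ / (-a)) * (1 - (derivative P).eval δ / P.eval δ)

/-- With $f=R/P$ and $k=1-P'(\delta)/P(\delta)$, the left side is $f(\delta)-f'(\delta)/k$.
Expanding $f$ in partial fractions, the comparison with $f(0)$ holds pole by pole: for a pole $-b$
it reads $b\le\delta k(b+\delta)$, the second clause of `ShiftCondition`. -/
theorem LowerPair.barrier_shift_le {P R : ℝ[X]} (h : LowerPair P R)
    (hsplit : P.Splits) (hpos : ∀ s, 0 ≤ s → 0 < P.eval s) (hnn : ∀ s, 0 ≤ s → 0 ≤ R.eval s)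
    {δ : ℝ} (hδ : 0 < δ) (hc : ShiftCondition P δ) :
    (R.eval δ - (derivative R).eval δ) / (P.eval δ - (derivative P).eval δ) ≤
      R.eval 0 / P.eval 0 := by
  obtain ⟨c, S, α, hS, hα, hf⟩ := h.partialFractions hsplit hpos hnn
  have hneg : ∀ a ∈ S, a < 0 := by
    intro a ha
    by_contra! h0
    exact (hpos a h0).ne' (mem_roots'.1 (hS a ha)).2
  have hPδ := hpos δ hδ.le
  have hder : HasDerivAt (fun s => c + ∑ a ∈ S, α a / (s - a)) (∑ a ∈ S, -α a / (δ - a) ^ 2) δ := by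
    refine HasDerivAt.const_add c (HasDerivAt.fun_sum fun a ha => ?_)
    have hne : δ - a ≠ 0 := by linarith [hneg a ha]
    simpa using (hasDerivAt_const δ (α a)).fun_div ((hasDerivAt_id δ).sub_const a) hne
  have hder2 : HasDerivAt (fun s => c + ∑ a ∈ S, α a / (s - a))
      (((derivative R).eval δ * P.eval δ - R.eval δ * (derivative P).eval δ) / P.eval δ ^ 2) δ := by
    refine ((R.hasDerivAt δ).fun_div (P.hasDerivAt δ) hPδ.ne').congr_of_eventuallyEq ?_
    filter_upwards [eventually_gt_nhds hδ] with s hs using (hf s hs.le).symm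
  have heq := hder2.unique hder
  set k := 1 - (derivative P).eval δ / P.eval δ with hk
  have hk0 : 0 < k := by
    rw [hk, sub_pos, div_lt_one hPδ]
    exact hc.1
  have hden : P.eval δ - (derivative P).eval δ = P.eval δ * k := by
    rw [hk]; field_simp
  have hlhs : (R.eval δ - (derivative R).eval δ) / (P.eval δ - (derivative P).eval δ) =
      R.eval δ / P.eval δ - ((derivative R).eval δ * P.eval δ -
        R.eval δ * (derivative P).eval δ) / P.eval δ ^ 2 / k := by
    rw [hden]
    have hP' : (derivative P).eval δ = P.eval δ * (1 - k) := by rw [hk]; field_simp; ring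
    rw [hP']
    field_simp
    ring
  rw [hlhs, heq, hf δ hδ.le, hf 0 le_rfl, Finset.sum_div, add_sub_assoc, ← Finset.sum_sub_distrib]
  gcongr with a ha
  have ha0 := hneg a ha
  have h1 := hc.2 a (hS a ha)
  rw [← hk] at h1
  obtain ⟨b, rfl⟩ : ∃ b, a = -b := ⟨-a, by ring⟩
  have hb : 0 < b := by linarith
  have hδb : 0 < δ + b := by linarith
  simp only [sub_neg_eq_add, zero_add, neg_neg] at h1 ⊢
  have h2 : b ≤ δ * k * (b + δ) := by
    have : δ * (1 + δ / b) * k = δ * k * (b + δ) / b := by field_simp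
    rwa [this, le_div_iff₀ hb, one_mul] at h1
  have h3 : α (-b) / b - (α (-b) / (δ + b) - -α (-b) / (δ + b) ^ 2 / k) =
      α (-b) * ((δ * k * (b + δ) - b) / (b * (δ + b) ^ 2 * k)) := by
    field_simp
    ring
  have h4 : 0 ≤ α (-b) * ((δ * k * (b + δ) - b) / (b * (δ + b) ^ 2 * k)) :=
    mul_nonneg (hα _ ha) (div_nonneg (by linarith) (by positivity))
  linarith

theorem root_neg_of_pos {P : ℝ[X]} (hpos : ∀ s, 0 ≤ s → 0 < P.eval s) {a : ℝ} (ha : a ∈ P.roots) :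
    a < 0 := by
  by_contra! h0
  exact (hpos a h0).ne' (mem_roots'.1 ha).2

theorem eval_derivative_zero_nonneg {P : ℝ[X]} (hsplit : P.Splits) (hpos : ∀ s, 0 ≤ s → 0 < P.eval s) :
    0 ≤ (derivative P).eval 0 := by
  rw [hsplit.eval_derivative_eq_eval_mul_sum (hpos 0 le_rfl).ne']
  refine mul_nonneg (hpos 0 le_rfl).le (Multiset.sum_nonneg fun x hx => ?_)
  obtain ⟨a, ha, rfl⟩ := Multiset.mem_map.1 hx
  have := root_neg_of_pos hpos ha
  exact one_div_nonneg.2 (by linarith)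

/-- $P'/P=\sum 1/(s-a)$ decreases on $[0,\infty)$, so the bound at $0$ persists at $\delta$. The
factor $1+\delta/(-a)\ge1$ is simply discarded. -/
theorem shiftCondition_of_le {P : ℝ[X]} (hsplit : P.Splits) (hpos : ∀ s, 0 ≤ s → 0 < P.eval s)
    {δ : ℝ} (hδ : 0 < δ) (hφ : (derivative P).eval 0 / P.eval 0 ≤ 1 - 1 / δ) :
    ShiftCondition P δ := by
  have hle : (derivative P).eval δ / P.eval δ ≤ 1 - 1 / δ := by
    refine le_trans ?_ hφ
    rw [hsplit.eval_derivative_div_eval_of_ne_zero (hpos δ hδ.le).ne',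
      hsplit.eval_derivative_div_eval_of_ne_zero (hpos 0 le_rfl).ne']
    refine Multiset.sum_map_le_sum_map _ _ fun a ha => ?_
    have := root_neg_of_pos hpos ha
    exact one_div_le_one_div_of_le (by linarith) (by linarith)
  have hδ' : 0 < 1 / δ := by positivity
  refine ⟨?_, fun a ha => ?_⟩
  · rw [← div_lt_one (hpos δ hδ.le)]
    linarith
  · have ha0 := root_neg_of_pos hpos ha
    have h1 : 0 ≤ δ / (-a) := div_nonneg hδ.le (by linarith)
    have h2 : 1 / δ ≤ 1 - (derivative P).eval δ / P.eval δ := by linarith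
    calc (1 : ℝ) = δ * 1 * (1 / δ) := by field_simp
      _ ≤ _ := by
        gcongr
        linarith

/-- `ShiftCondition` for a quadratic with roots $-1/u,-1/w$ and $\delta=1+\eta$, at the root $-1/w$.
Here the factor $1+\delta/(-a)$ is kept, which is the source of the sharper bound. -/
theorem two_root_inequality {η u w : ℝ} (hη : 0 < η) (hη1 : η < 1) (hu : 0 ≤ u) (hw : 0 ≤ w)
    (huw : u + w ≤ η / (1 - η ^ 2)) :
    1 ≤ (1 + η) * (1 + (1 + η) * w) *
      (1 - (u / (1 + (1 + η) * u) + w / (1 + (1 + η) * w))) := by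
  have h1 : 0 < 1 - η ^ 2 := by nlinarith
  rw [le_div_iff₀ h1] at huw
  have hU : 0 < 1 + (1 + η) * u := by positivity
  have hW : 0 < 1 + (1 + η) * w := by positivity
  -- The expression factors as $(1+(1+\eta)w)(\eta-(1-\eta^2)u)$.
  have hE : 0 ≤ η + (1 + η) * η * (u + w) - (1 + η) * (1 - η ^ 2) * (u * w) - (1 + η) * u := by
    have h2 : 0 ≤ (1 + η) * w * (η - (1 - η ^ 2) * u) := by
      refine mul_nonneg (by positivity) ?_
      nlinarith
    nlinarith
  have h3 : (1 + η) * (1 + (1 + η) * w) *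
      (1 - (u / (1 + (1 + η) * u) + w / (1 + (1 + η) * w))) - 1 =
      (η + (1 + η) * η * (u + w) - (1 + η) * (1 - η ^ 2) * (u * w) - (1 + η) * u) /
        (1 + (1 + η) * u) := by
    field_simp
    ring
  have h4 := div_nonneg hE hU.le
  linarith

theorem shiftCondition_of_natDegree_le_two {P : ℝ[X]} (hsplit : P.Splits)
    (hpos : ∀ s, 0 ≤ s → 0 < P.eval s) (hdeg : P.natDegree ≤ 2) {η : ℝ} (hη : 0 < η) (hη1 : η < 1)
    (hφ : (derivative P).eval 0 / P.eval 0 ≤ η / (1 - η ^ 2)) :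
    ShiftCondition P (1 + η) := by
  have hδ : 0 < 1 + η := by linarith
  have hcard : Multiset.card P.roots ≤ 2 := (card_roots' P).trans hdeg
  have h0 := hsplit.eval_derivative_div_eval_of_ne_zero (hpos 0 le_rfl).ne'
  have h1 := hsplit.eval_derivative_div_eval_of_ne_zero (hpos (1 + η) hδ.le).ne'
  have hterm : ∀ a ∈ P.roots, 1 / (1 + η - a) = (1 / -a) / (1 + (1 + η) * (1 / -a)) := by
    intro a ha
    have := root_neg_of_pos hpos ha
    have ha' : a ≠ 0 := this.ne
    have h2 : 1 + η - a ≠ 0 := by linarith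
    have h3 : -a + (1 + η) ≠ 0 := by linarith
    have h4 : 1 + (1 + η) * (1 / -a) = (-a + (1 + η)) / (-a) := by
      field_simp
      ring
    rw [h4]
    field_simp
    ring
  have hu : ∀ a ∈ P.roots, 0 ≤ 1 / -a := fun a ha =>
    one_div_nonneg.2 (by linarith [root_neg_of_pos hpos ha])
  -- Degrees below two are covered by letting $u$ or $w$ be $0$, a root at infinity.
  suffices H : ∃ u w : ℝ, 0 ≤ u ∧ 0 ≤ w ∧ u + w ≤ η / (1 - η ^ 2) ∧
      (derivative P).eval (1 + η) / P.eval (1 + η) =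
        u / (1 + (1 + η) * u) + w / (1 + (1 + η) * w) ∧ ∀ a ∈ P.roots, 1 / -a = u ∨ 1 / -a = w by
    obtain ⟨u, w, hu0, hw0, huw, he, hr⟩ := H
    have hw := two_root_inequality hη hη1 hu0 hw0 huw
    have hu := two_root_inequality hη hη1 hw0 hu0 (by linarith)
    refine ⟨?_, fun a ha => ?_⟩
    · rw [← div_lt_one (hpos (1 + η) hδ.le), he]
      have h5 : 0 < (1 + η) * (1 + (1 + η) * w) := by positivity
      have := (pos_iff_pos_of_mul_pos (zero_lt_one.trans_le hw)).1 h5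
      linarith
    · rw [he, ← mul_one_div (1 + η) (-a)]
      rcases hr a ha with h | h
      · rw [h, add_comm (u / _)]
        exact hu
      · rw [h]
        exact hw
  rw [h0] at hφ
  rw [h1]
  interval_cases hc : Multiset.card P.roots
  · rw [Multiset.card_eq_zero] at hc
    refine ⟨0, 0, le_rfl, le_rfl, ?_, ?_, ?_⟩
    · simpa [hc] using hφ
    · simp [hc]
    · simp [hc]
  · obtain ⟨a, ha⟩ := Multiset.card_eq_one.1 hc
    have ham : a ∈ P.roots := by simp [ha]
    refine ⟨1 / -a, 0, hu a ham, le_rfl, ?_, ?_, ?_⟩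
    · simpa [ha] using hφ
    · rw [ha, Multiset.map_singleton, Multiset.sum_singleton, hterm a ham]
      simp
    · simp [ha]
  · obtain ⟨a, b, hab⟩ := Multiset.card_eq_two.1 hc
    have ham : a ∈ P.roots := by simp [hab]
    have hbm : b ∈ P.roots := by simp [hab]
    refine ⟨1 / -a, 1 / -b, hu a ham, hu b hbm, ?_, ?_, ?_⟩
    · simpa [hab] using hφ
    · rw [hab]
      simp only [Multiset.insert_eq_cons, Multiset.map_cons, Multiset.sum_cons,
        Multiset.map_singleton, Multiset.sum_singleton]
      rw [hterm a ham, hterm b hbm]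
    · simp [hab]

end Univariate

/-! ### Real stable polynomials and the multivariate barrier argument. -/

section Multivariate

open Filter Topology
open scoped ComplexConjugate

variable {σ : Type*}

/-- The directional derivative `∑ k, a k * ∂ₖ`. -/
noncomputable def dirDeriv (a : σ → ℝ) :
    Derivation ℝ (MvPolynomial σ ℝ) (MvPolynomial σ ℝ) :=
  MvPolynomial.mkDerivation ℝ fun k => MvPolynomial.C (a k)

theorem dirDeriv_X (a : σ → ℝ) (k : σ) :
    dirDeriv a (MvPolynomial.X k) = MvPolynomial.C (a k) :=
  MvPolynomial.mkDerivation_X _ _ _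

theorem dirDeriv_comm (a b : σ → ℝ) (p : MvPolynomial σ ℝ) :
    dirDeriv a (dirDeriv b p) = dirDeriv b (dirDeriv a p) := by
  have h : ⁅dirDeriv a, dirDeriv b⁆ = 0 := by
    refine MvPolynomial.derivation_ext fun k => ?_
    simp [Derivation.commutator_apply, dirDeriv_X]
  have := congrArg (fun D => D p) h
  simpa [Derivation.commutator_apply, sub_eq_zero] using this

theorem dirDeriv_add (a b : σ → ℝ) : dirDeriv (a + b) = dirDeriv a + dirDeriv b :=
  MvPolynomial.derivation_ext fun k => by simp [dirDeriv_X]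

theorem dirDeriv_smul (c : ℝ) (a : σ → ℝ) : dirDeriv (c • a) = c • dirDeriv a :=
  MvPolynomial.derivation_ext fun k => by simp [dirDeriv_X, MvPolynomial.smul_eq_C_mul]

theorem dirDeriv_zero : dirDeriv (0 : σ → ℝ) = 0 :=
  MvPolynomial.derivation_ext fun k => by simp [dirDeriv_X]

theorem dirDeriv_sum {ι : Type*} (s : Finset ι) (a : ι → σ → ℝ) (p : MvPolynomial σ ℝ) :
    dirDeriv (∑ i ∈ s, a i) p = ∑ i ∈ s, dirDeriv (a i) p := by
  classical
  induction s using Finset.induction_on with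
  | empty => simp [dirDeriv_zero]
  | insert i s hi ih => rw [Finset.sum_insert hi, Finset.sum_insert hi, dirDeriv_add, Derivation.add_apply,
      ih]

/-- The restriction `s ↦ p (z + s • a)` of `p` to a line, as a polynomial in `s`. -/
noncomputable def lineRestrict {K : Type*} [Field K] [Algebra ℝ K] (z : σ → K) (a : σ → ℝ) :
    MvPolynomial σ ℝ →ₐ[ℝ] Polynomial K :=
  MvPolynomial.aeval fun k =>
    Polynomial.C (z k) + Polynomial.C (algebraMap ℝ K (a k)) * Polynomial.X

theorem derivative_lineRestrict {K : Type*} [Field K] [Algebra ℝ K] (z : σ → K) (a : σ → ℝ)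
    (p : MvPolynomial σ ℝ) :
    Polynomial.derivative (lineRestrict z a p) = lineRestrict z a (dirDeriv a p) := by
  induction p using MvPolynomial.induction_on with
  | C r => simp [lineRestrict, MvPolynomial.derivation_C,
      IsScalarTower.algebraMap_apply ℝ K (Polynomial K)]
  | add p q hp hq => simp [hp, hq]
  | mul_X p k hp =>
    rw [map_mul, Polynomial.derivative_mul, hp, Derivation.leibniz, dirDeriv_X]
    simp [lineRestrict, IsScalarTower.algebraMap_apply ℝ K (Polynomial K)]
    ring

theorem eval_lineRestrict {K : Type*} [Field K] [Algebra ℝ K] (z : σ → K) (a : σ → ℝ)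
    (p : MvPolynomial σ ℝ) (s : K) :
    (lineRestrict z a p).eval s = MvPolynomial.aeval (fun k => z k + algebraMap ℝ K (a k) * s) p := by
  have h := MvPolynomial.map_aeval (fun k =>
    Polynomial.C (z k) + Polynomial.C (algebraMap ℝ K (a k)) * Polynomial.X)
    (Polynomial.evalRingHom s) p
  simp only [Polynomial.coe_evalRingHom] at h
  have hr : (Polynomial.evalRingHom s).comp (algebraMap ℝ (Polynomial K)) = algebraMap ℝ K := by
    ext r
    simp [IsScalarTower.algebraMap_apply ℝ K (Polynomial K)]
  rw [lineRestrict, h, MvPolynomial.aeval_def, hr]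
  simp

theorem eval_lineRestrict_real (x a : σ → ℝ) (p : MvPolynomial σ ℝ) (s : ℝ) :
    (lineRestrict x a p).eval s = MvPolynomial.eval (x + s • a) p := by
  rw [eval_lineRestrict, MvPolynomial.aeval_eq_eval]
  congr 2
  ext k
  simp [mul_comm]

theorem aeval_lineRestrict_real (x a : σ → ℝ) (p : MvPolynomial σ ℝ) (s : ℂ) :
    Polynomial.aeval s (lineRestrict x a p) =
      MvPolynomial.aeval (fun k => (x k : ℂ) + a k * s) p := by
  have h := MvPolynomial.map_aeval (fun k =>
    Polynomial.C (x k) + Polynomial.C (algebraMap ℝ ℝ (a k)) * Polynomial.X)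
    (Polynomial.aeval (R := ℝ) s).toRingHom p
  have hr : (Polynomial.aeval (R := ℝ) s).toRingHom.comp (algebraMap ℝ (Polynomial ℝ)) =
      algebraMap ℝ ℂ := by
    ext r
    simp
  rw [hr] at h
  refine h.trans ?_
  rw [MvPolynomial.coe_eval₂Hom, MvPolynomial.aeval_def]
  simp

theorem continuous_mvAeval (p : MvPolynomial σ ℝ) :
    Continuous fun z : σ → ℂ => MvPolynomial.aeval z p := by
  have h := MvPolynomial.continuous_eval (MvPolynomial.map (algebraMap ℝ ℂ) p)
  simpa [MvPolynomial.eval_map, MvPolynomial.aeval_def] using h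

/-- A real polynomial without zeros in the product of open upper half-planes. -/
def Stable (p : MvPolynomial σ ℝ) : Prop :=
  ∀ z : σ → ℂ, (∀ k, 0 < (z k).im) → MvPolynomial.aeval z p ≠ 0

/-- The roots $r$ of $s\mapsto p(z+sa)$ lie in the open lower half-plane, so each term of the
logarithmic derivative $\sum 1/(0-r)$ has negative imaginary part. The ratio could be the real
number $1$ only if there were no roots, but then it is $0$. -/
theorem Stable.logDeriv {p : MvPolynomial σ ℝ} (hp : Stable p) {a : σ → ℝ} (ha : 0 ≤ a)
    {z : σ → ℂ} (hz : ∀ k, 0 < (z k).im) :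
    (MvPolynomial.aeval z (dirDeriv a p) / MvPolynomial.aeval z p).im ≤ 0 ∧
      MvPolynomial.aeval z (dirDeriv a p) ≠ MvPolynomial.aeval z p := by
  set S := lineRestrict z a p with hS
  have h0 : S.eval 0 = MvPolynomial.aeval z p := by rw [hS, eval_lineRestrict]; simp
  have h1 : S.derivative.eval 0 = MvPolynomial.aeval z (dirDeriv a p) := by
    rw [hS, derivative_lineRestrict, eval_lineRestrict]; simp
  have hne : S.eval 0 ≠ 0 := h0 ▸ hp z hz
  have hroot : ∀ r ∈ S.roots, r.im < 0 := by
    intro r hr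
    by_contra! hr0
    refine hp (fun k => z k + algebraMap ℝ ℂ (a k) * r) (fun k => ?_) ?_
    · have := mul_nonneg (ha k) hr0
      have := hz k
      simp
      positivity
    · rw [← eval_lineRestrict]
      exact (Polynomial.mem_roots'.1 hr).2
  have hterm : ∀ r ∈ S.roots, (1 / (0 - r)).im < 0 := by
    intro r hr
    have hr0 := hroot r hr
    have hrne : r ≠ 0 := by rintro rfl; simp at hr0
    rw [zero_sub, one_div, Complex.inv_im, Complex.neg_im, neg_neg]
    exact div_neg_of_neg_of_pos hr0 (Complex.normSq_pos.2 (neg_ne_zero.2 hrne))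
  have hlog := (IsAlgClosed.splits S).eval_derivative_div_eval_of_ne_zero hne
  have him : (S.derivative.eval 0 / S.eval 0).im =
      (S.roots.map fun r => (1 / (0 - r)).im).sum := by
    rw [hlog, ← Complex.coe_imAddGroupHom, map_multiset_sum, Multiset.map_map]
    rfl
  rw [← h0, ← h1]
  refine ⟨?_, fun he => ?_⟩
  · rw [him]
    have := Multiset.sum_map_le_sum_map (s := S.roots) (fun r => (1 / (0 - r)).im) (fun _ => 0)
      fun r hr => (hterm r hr).le
    simpa only [Multiset.map_const', Multiset.sum_replicate, smul_zero] using this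
  · rw [he, div_self hne, Complex.one_im] at him
    have hempty : S.roots = 0 := by
      by_contra hr
      obtain ⟨r, hr⟩ := Multiset.exists_mem_of_ne_zero hr
      have := Multiset.sum_lt_sum (s := S.roots) (f := fun r => (1 / (0 - r)).im)
        (g := fun _ => 0) (fun r hr => (hterm r hr).le) ⟨r, hr, hterm r hr⟩
      simp only [Multiset.map_const', Multiset.sum_replicate, smul_zero] at this
      linarith
    rw [he, div_self hne, hempty] at hlog
    simp at hlog

theorem Stable.sub_dirDeriv {p : MvPolynomial σ ℝ} (hp : Stable p) {a : σ → ℝ} (ha : 0 ≤ a) :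
    Stable (p - dirDeriv a p) := by
  intro z hz
  rw [map_sub, sub_ne_zero]
  exact (hp.logDeriv ha hz).2.symm

/-- The product form passes to the boundary by continuity. Real coordinates must be allowed because
a line $x+sa$ is constant where $a_k=0$. -/
theorem Stable.im_dirDeriv_mul_conj_nonpos {p : MvPolynomial σ ℝ} (hp : Stable p) {a : σ → ℝ}
    (ha : 0 ≤ a) {z : σ → ℂ} (hz : ∀ k, 0 ≤ (z k).im) :
    (MvPolynomial.aeval z (dirDeriv a p) * conj (MvPolynomial.aeval z p)).im ≤ 0 := by
  have hopen : ∀ w : σ → ℂ, (∀ k, 0 < (w k).im) →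
      (MvPolynomial.aeval w (dirDeriv a p) * conj (MvPolynomial.aeval w p)).im ≤ 0 := by
    intro w hw
    have h1 := (hp.logDeriv ha hw).1
    have hne := hp w hw
    have h2 : MvPolynomial.aeval w (dirDeriv a p) * conj (MvPolynomial.aeval w p) =
        ((Complex.normSq (MvPolynomial.aeval w p) : ℝ) : ℂ) *
          (MvPolynomial.aeval w (dirDeriv a p) / MvPolynomial.aeval w p) := by
      rw [Complex.normSq_eq_conj_mul_self]
      field_simp
    rw [h2, Complex.im_ofReal_mul]
    exact mul_nonpos_of_nonneg_of_nonpos (Complex.normSq_nonneg _) h1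
  have hc : Continuous fun t : ℝ =>
      (MvPolynomial.aeval (fun k => z k + t * Complex.I) (dirDeriv a p) *
        conj (MvPolynomial.aeval (fun k => z k + t * Complex.I) p)).im := by
    have h1 : ∀ q : MvPolynomial σ ℝ, Continuous fun t : ℝ =>
        MvPolynomial.aeval (fun k => z k + t * Complex.I) q := fun q =>
      (continuous_mvAeval q).comp (by fun_prop)
    exact Complex.continuous_im.comp ((h1 _).mul (Complex.continuous_conj.comp (h1 p)))
  have hlim := (hc.tendsto 0).mono_left (nhdsWithin_le_nhds (s := Set.Ioi 0))
  simp only [Complex.ofReal_zero, zero_mul, add_zero] at hlim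
  refine le_of_tendsto hlim ?_
  filter_upwards [self_mem_nhdsWithin] with t ht
  exact hopen _ fun k => by
    have := hz k
    have ht' : 0 < t := ht
    simp
    positivity

theorem Stable.lowerPair {p : MvPolynomial σ ℝ} (hp : Stable p) {a b : σ → ℝ} (ha : 0 ≤ a)
    (hb : 0 ≤ b) (x : σ → ℝ) :
    LowerPair (lineRestrict x a p) (lineRestrict x a (dirDeriv b p)) := by
  intro s hs
  rw [aeval_lineRestrict_real, aeval_lineRestrict_real]
  refine hp.im_dirDeriv_mul_conj_nonpos hb fun k => ?_
  have := mul_nonneg (ha k) hs.le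
  simpa using this

theorem Stable.splits_lineRestrict {p : MvPolynomial σ ℝ} (hp : Stable p) {a : σ → ℝ} (ha : 0 ≤ a)
    {x : σ → ℝ} (h : lineRestrict x a p ≠ 0) : (lineRestrict x a p).Splits := by
  refine LowerPair.splits h ?_
  rw [derivative_lineRestrict]
  exact hp.lowerPair ha ha x

/-- `x` lies above the zeros of `p`: `p` is positive on the orthant with vertex `x`. -/
def AboveZeros (p : MvPolynomial σ ℝ) (x : σ → ℝ) : Prop :=
  ∀ y, x ≤ y → 0 < MvPolynomial.eval y p

/-- The barrier function `Dₐ p / p`. -/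
noncomputable def barrier (a : σ → ℝ) (p : MvPolynomial σ ℝ) (x : σ → ℝ) : ℝ :=
  MvPolynomial.eval x (dirDeriv a p) / MvPolynomial.eval x p

theorem AboveZeros.mono {p : MvPolynomial σ ℝ} {x y : σ → ℝ} (h : AboveZeros p x) (hxy : x ≤ y) :
    AboveZeros p y := fun w hw => h w (hxy.trans hw)

theorem AboveZeros.lineRestrict_pos {p : MvPolynomial σ ℝ} {x a : σ → ℝ} (h : AboveZeros p x)
    (ha : 0 ≤ a) (s : ℝ) (hs : 0 ≤ s) : 0 < (lineRestrict x a p).eval s := by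
  rw [eval_lineRestrict_real]
  exact h _ (le_add_of_nonneg_right (smul_nonneg hs ha))

theorem AboveZeros.splits {p : MvPolynomial σ ℝ} {x a : σ → ℝ} (h : AboveZeros p x)
    (hp : Stable p) (ha : 0 ≤ a) : (lineRestrict x a p).Splits :=
  hp.splits_lineRestrict ha fun h0 => by
    simpa [h0] using h.lineRestrict_pos ha 0 le_rfl

theorem lineRestrict_eval_zero (x a : σ → ℝ) (p : MvPolynomial σ ℝ) :
    (lineRestrict x a p).eval 0 = MvPolynomial.eval x p := by
  rw [eval_lineRestrict_real, zero_smul, add_zero]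

theorem AboveZeros.dirDeriv_nonneg {p : MvPolynomial σ ℝ} {x a : σ → ℝ} (h : AboveZeros p x)
    (hp : Stable p) (ha : 0 ≤ a) : 0 ≤ MvPolynomial.eval x (dirDeriv a p) := by
  have := eval_derivative_zero_nonneg (h.splits hp ha) (h.lineRestrict_pos ha)
  rwa [derivative_lineRestrict, lineRestrict_eval_zero] at this

theorem AboveZeros.barrier_anti {p : MvPolynomial σ ℝ} {x y b : σ → ℝ} (h : AboveZeros p x)
    (hp : Stable p) (hb : 0 ≤ b) (hxy : x ≤ y) : barrier b p y ≤ barrier b p x := by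
  have ha : 0 ≤ y - x := sub_nonneg.2 hxy
  have := LowerPair.antitoneOn_div (convex_Ici 0) (hp.lowerPair ha hb x)
    (h.lineRestrict_pos ha) (Set.mem_Ici.2 le_rfl) (Set.mem_Ici.2 zero_le_one) zero_le_one
  simp only [eval_lineRestrict_real, one_smul, zero_smul, add_zero, add_sub_cancel] at this
  exact this

theorem barrier_eq_derivative_div (a : σ → ℝ) (p : MvPolynomial σ ℝ) (x : σ → ℝ) :
    barrier a p x =
      (lineRestrict x a p).derivative.eval 0 / (lineRestrict x a p).eval 0 := by
  rw [derivative_lineRestrict, lineRestrict_eval_zero, lineRestrict_eval_zero, barrier]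

/-- Positivity at $y\ge x+\delta a$ is the first clause of `ShiftCondition` based at $y-\delta a$,
hence the hypothesis at all points above $x$. Since $D_b$ and $D_a$ commute, the barrier bound is
`LowerPair.barrier_shift_le` for $R=D_bp$ on the line through $x$. -/
theorem AboveZeros.sub_dirDeriv {p : MvPolynomial σ ℝ} {x a : σ → ℝ} (h : AboveZeros p x)
    (hp : Stable p) (ha : 0 ≤ a) {δ : ℝ} (hδ : 0 < δ)
    (hc : ∀ y, x ≤ y → ShiftCondition (lineRestrict y a p) δ) :
    AboveZeros (p - dirDeriv a p) (x + δ • a) ∧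
      ∀ b, 0 ≤ b → barrier b (p - dirDeriv a p) (x + δ • a) ≤ barrier b p x := by
  constructor
  · intro y hy
    have hy' : x ≤ y - δ • a := le_sub_iff_add_le.2 hy
    have h1 := (hc _ hy').1
    rw [derivative_lineRestrict, eval_lineRestrict_real, eval_lineRestrict_real,
      sub_add_cancel] at h1
    rw [map_sub, sub_pos]
    exact h1
  · intro b hb
    have h1 := (hp.lowerPair ha hb x).barrier_shift_le (h.splits hp ha) (h.lineRestrict_pos ha)
      (fun s hs => by
        rw [eval_lineRestrict_real]
        exact (h.mono (le_add_of_nonneg_right (smul_nonneg hs ha))).dirDeriv_nonneg hp hb)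
      hδ (hc x le_rfl)
    simp only [derivative_lineRestrict, eval_lineRestrict_real, zero_smul, add_zero] at h1
    rw [barrier, map_sub (dirDeriv b), dirDeriv_comm b a, map_sub, map_sub]
    exact h1

/-- The composition of the operators `1 - Dₐ` for `a` in the list `l`. -/
noncomputable def subDirDerivs (l : List (σ → ℝ)) (p : MvPolynomial σ ℝ) : MvPolynomial σ ℝ :=
  l.foldr (fun a q => q - dirDeriv a q) p

theorem subDirDerivs_cons (a : σ → ℝ) (l : List (σ → ℝ)) (p : MvPolynomial σ ℝ) :
    subDirDerivs (a :: l) p = subDirDerivs l p - dirDeriv a (subDirDerivs l p) := rfl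

theorem subDirDerivs_perm {l l' : List (σ → ℝ)} (h : l.Perm l') (p : MvPolynomial σ ℝ) :
    subDirDerivs l p = subDirDerivs l' p := by
  have : LeftCommutative fun (a : σ → ℝ) (q : MvPolynomial σ ℝ) => q - dirDeriv a q :=
    ⟨fun a b q => by
      simp only [map_sub, dirDeriv_comm a b]
      abel⟩
  exact h.foldr_eq p

theorem dirDeriv_subDirDerivs (b : σ → ℝ) (l : List (σ → ℝ)) (p : MvPolynomial σ ℝ) :
    dirDeriv b (subDirDerivs l p) = subDirDerivs l (dirDeriv b p) := by
  induction l with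
  | nil => rfl
  | cons a l ih => rw [subDirDerivs_cons, subDirDerivs_cons, map_sub, dirDeriv_comm, ih]

theorem subDirDerivs_zero (l : List (σ → ℝ)) : subDirDerivs l 0 = 0 := by
  induction l with
  | nil => rfl
  | cons a l ih => rw [subDirDerivs_cons, ih, map_zero, sub_zero]

theorem Stable.subDirDerivs {p : MvPolynomial σ ℝ} (hp : Stable p) {l : List (σ → ℝ)}
    (hl : ∀ a ∈ l, 0 ≤ a) : Stable (subDirDerivs l p) := by
  induction l with
  | nil => exact hp
  | cons a l ih =>
    exact (ih fun b hb => hl b (List.mem_cons_of_mem _ hb)).sub_dirDeriv (hl a List.mem_cons_self)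

/-- The barrier argument: if the polynomials in a class closed under the operators `1 - Dₐ` satisfy
the shift condition wherever the barrier is at most `φ`, then each operator moves the point above
the zeros by at most `δ • a`. -/
theorem AboveZeros.subDirDerivs {p : MvPolynomial σ ℝ} {x : σ → ℝ} (h : AboveZeros p x)
    (hp : Stable p) {l : List (σ → ℝ)} (hl : ∀ a ∈ l, 0 ≤ a) {δ φ : ℝ} (hδ : 0 < δ)
    (hφ : ∀ a ∈ l, barrier a p x ≤ φ)
    (hc : ∀ (l' : List (σ → ℝ)) (y : σ → ℝ), ∀ a ∈ l, AboveZeros (subDirDerivs l' p) y →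
      Stable (_root_.subDirDerivs l' p) → barrier a (_root_.subDirDerivs l' p) y ≤ φ →
      ShiftCondition (lineRestrict y a (_root_.subDirDerivs l' p)) δ) :
    AboveZeros (_root_.subDirDerivs l p) (x + δ • l.sum) ∧
      ∀ b, 0 ≤ b → barrier b (_root_.subDirDerivs l p) (x + δ • l.sum) ≤ barrier b p x := by
  induction l with
  | nil => simpa [_root_.subDirDerivs] using h
  | cons a l ih =>
    have hl' : ∀ b ∈ l, 0 ≤ b := fun b hb => hl b (List.mem_cons_of_mem _ hb)
    obtain ⟨h1, h2⟩ := ih hl' (fun b hb => hφ b (List.mem_cons_of_mem _ hb))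
      (fun l' y b hb => hc l' y b (List.mem_cons_of_mem _ hb))
    have ha := hl a List.mem_cons_self
    have hst := hp.subDirDerivs hl'
    obtain ⟨h3, h4⟩ := h1.sub_dirDeriv hst ha hδ fun y hy =>
      hc l y a List.mem_cons_self (h1.mono hy) hst
        ((h1.barrier_anti hst ha hy).trans ((h2 a ha).trans (hφ a List.mem_cons_self)))
    have hsum : x + δ • (a :: l).sum = x + δ • l.sum + δ • a := by
      rw [List.sum_cons, smul_add]
      abel
    rw [hsum]
    exact ⟨h3, fun b hb => (h4 b hb).trans (h2 b hb)⟩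

theorem AboveZeros.subDirDerivs_of_barrier_le {p : MvPolynomial σ ℝ} {x : σ → ℝ}
    (h : AboveZeros p x) (hp : Stable p) {l : List (σ → ℝ)} (hl : ∀ a ∈ l, 0 ≤ a) {δ : ℝ}
    (hδ : 0 < δ) (hφ : ∀ a ∈ l, barrier a p x ≤ 1 - 1 / δ) :
    AboveZeros (_root_.subDirDerivs l p) (x + δ • l.sum) := by
  refine (h.subDirDerivs hp hl hδ hφ fun l' y a ha hab hst hle => ?_).1
  rw [barrier_eq_derivative_div] at hle
  exact shiftCondition_of_le (hab.splits hst (hl a ha)) (hab.lineRestrict_pos (hl a ha)) hδ hle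

theorem natDegree_lineRestrict_le_two {p : MvPolynomial σ ℝ} {a : σ → ℝ}
    (h : dirDeriv a (dirDeriv a (dirDeriv a p)) = 0) (x : σ → ℝ) :
    (lineRestrict x a p).natDegree ≤ 2 := by
  have h3 : (Polynomial.derivative^[3] (lineRestrict x a p)) = 0 := by
    simp [derivative_lineRestrict, h]
  rw [Polynomial.natDegree_le_iff_coeff_eq_zero]
  intro n hn
  obtain ⟨m, rfl⟩ : ∃ m, n = m + 3 := ⟨n - 3, by omega⟩
  have h4 := Polynomial.coeff_iterate_derivative (k := 3) (lineRestrict x a p) m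
  rw [h3, Polynomial.coeff_zero, eq_comm, smul_eq_zero] at h4
  exact h4.resolve_left (Nat.descFactorial_pos.2 (by omega)).ne'

theorem AboveZeros.subDirDerivs_of_quadratic {p : MvPolynomial σ ℝ} {x : σ → ℝ}
    (h : AboveZeros p x) (hp : Stable p) {l : List (σ → ℝ)} (hl : ∀ a ∈ l, 0 ≤ a)
    (hquad : ∀ a ∈ l, dirDeriv a (dirDeriv a (dirDeriv a p)) = 0) {η : ℝ}
    (hη : 0 < η) (hη1 : η < 1) (hφ : ∀ a ∈ l, barrier a p x ≤ η / (1 - η ^ 2)) :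
    AboveZeros (_root_.subDirDerivs l p) (x + (1 + η) • l.sum) := by
  refine (h.subDirDerivs hp hl (by linarith) hφ fun l' y a ha hab hst hle => ?_).1
  rw [barrier_eq_derivative_div] at hle
  refine shiftCondition_of_natDegree_le_two (hab.splits hst (hl a ha))
    (hab.lineRestrict_pos (hl a ha)) (natDegree_lineRestrict_le_two ?_ y) hη hη1 hle
  -- $D_a^3$ commutes with every $1-D_b$, so it still annihilates the transformed polynomial.
  rw [dirDeriv_subDirDerivs, dirDeriv_subDirDerivs, dirDeriv_subDirDerivs, hquad a ha,
    subDirDerivs_zero]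

end Multivariate

/-! ### Interlacing: replacing averages by actual values. -/

section Selection

open Filter Topology

variable {σ : Type*}

theorem eval_lineRestrict_ray (e : σ → ℝ) (B s : ℝ) (q : MvPolynomial σ ℝ) :
    (lineRestrict (B • e) e q).eval s = MvPolynomial.eval ((B + s) • e) q := by
  rw [eval_lineRestrict_real, add_smul]

/-- Let $\rho\ge B$ be the last parameter with $G(\rho e)\le0$. Beyond it $D_aG/G$ is decreasing and
is nonnegative far out, so $D_aG\ge0$ there and, by continuity, at $\rho$. Then $G-D_aG\le0$ at
$\rho e$, a contradiction. -/
theorem Stable.pos_on_ray_of_sub_dirDeriv {G : MvPolynomial σ ℝ} (hG : Stable G) {e a : σ → ℝ}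
    (he : 0 ≤ e) (ha : 0 ≤ a) {t : ℝ} (hfar : AboveZeros G (t • e)) {B : ℝ}
    (hpos : ∀ x, B ≤ x → 0 < MvPolynomial.eval (x • e) (G - dirDeriv a G)) :
    ∀ x, B ≤ x → 0 < MvPolynomial.eval (x • e) G := by
  by_contra! hcon
  set Z : Set ℝ := {x | B ≤ x ∧ MvPolynomial.eval (x • e) G ≤ 0} with hZ
  have hcont : ∀ q : MvPolynomial σ ℝ, Continuous fun x : ℝ => MvPolynomial.eval (x • e) q :=
    fun q => (MvPolynomial.continuous_eval q).comp (by fun_prop)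
  have hZc : IsClosed Z := isClosed_Ici.inter (isClosed_le (hcont G) continuous_const)
  have hte : ∀ x, t ≤ x → AboveZeros G (x • e) := fun x hx =>
    hfar.mono (smul_le_smul_of_nonneg_right hx he)
  have hZb : BddAbove Z := ⟨t, fun x hx => by
    by_contra! hlt
    exact absurd (hte x hlt.le _ le_rfl) (not_lt.2 hx.2)⟩
  have hρ : sSup Z ∈ Z := hZc.csSup_mem hcon hZb
  set ρ := sSup Z
  have hP : ∀ s ∈ Set.Ioi (0 : ℝ), 0 < (lineRestrict (ρ • e) e G).eval s := by
    intro s hs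
    rw [eval_lineRestrict_ray]
    by_contra! h0
    have h1 : ρ + s ∈ Z := ⟨by linarith [hρ.1, Set.mem_Ioi.1 hs], h0⟩
    linarith [le_csSup hZb h1, Set.mem_Ioi.1 hs]
  have hanti := LowerPair.antitoneOn_div (convex_Ioi 0) (hG.lowerPair he ha (ρ • e)) hP
  have hR : ∀ s ∈ Set.Ioi (0 : ℝ), 0 ≤ MvPolynomial.eval ((ρ + s) • e) (dirDeriv a G) := by
    intro s hs
    have hs' : s ≤ max s (t - ρ) := le_max_left _ _
    have h1 := hanti hs (lt_of_lt_of_le hs hs') hs'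
    have h2 := hte (ρ + max s (t - ρ)) (by linarith [le_max_right s (t - ρ)])
    simp only [eval_lineRestrict_ray] at h1
    have h3 := hP s hs
    rw [eval_lineRestrict_ray] at h3
    have h4 := (div_nonneg (h2.dirDeriv_nonneg hG ha) (h2 _ le_rfl).le).trans h1
    rwa [le_div_iff₀ h3, zero_mul] at h4
  have hRρ : 0 ≤ MvPolynomial.eval (ρ • e) (dirDeriv a G) := by
    have hc : Continuous fun s : ℝ => MvPolynomial.eval ((ρ + s) • e) (dirDeriv a G) :=
      (hcont _).comp (by fun_prop)
    have hlim := (hc.tendsto 0).mono_left (nhdsWithin_le_nhds (s := Set.Ioi 0))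
    rw [add_zero] at hlim
    exact ge_of_tendsto hlim (by filter_upwards [self_mem_nhdsWithin] with s hs using hR s hs)
  have := hpos ρ hρ.1
  rw [map_sub] at this
  linarith [hρ.2]

/-- One step of the method of interlacing families. -/
theorem Stable.exists_sub_dirDeriv_pos_on_ray {G : MvPolynomial σ ℝ} (hG : Stable G) {e : σ → ℝ}
    (he : 0 ≤ e) {t : ℝ} (hfar : AboveZeros G (t • e)) {B : ℝ} {κ : Type*} [Fintype κ]
    (b : κ → σ → ℝ) (hb : ∀ j, 0 ≤ b j) (w : κ → ℝ) (hw : ∀ j, 0 ≤ w j) (hw1 : ∑ j, w j = 1)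
    (hpos : ∀ x, B ≤ x →
      0 < MvPolynomial.eval (x • e) (G - dirDeriv (∑ j, w j • b j) G)) :
    ∃ j, 0 < w j ∧ ∀ x, B ≤ x → 0 < MvPolynomial.eval (x • e) (G - dirDeriv (b j) G) := by
  have hGpos := hG.pos_on_ray_of_sub_dirDeriv he
    (Finset.sum_nonneg fun j _ => smul_nonneg (hw j) (hb j)) hfar hpos
  have hsum : MvPolynomial.eval (B • e) (G - dirDeriv (∑ j, w j • b j) G) =
      ∑ j, w j * MvPolynomial.eval (B • e) (G - dirDeriv (b j) G) := by
    have h1 : dirDeriv (∑ j, w j • b j) G = ∑ j, w j • dirDeriv (b j) G := by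
      rw [dirDeriv_sum]
      simp [dirDeriv_smul]
    simp only [h1, map_sub, map_sum, MvPolynomial.smul_eval, mul_sub, Finset.sum_sub_distrib,
      ← Finset.sum_mul, hw1, one_mul]
  have h0 := hpos B le_rfl
  rw [hsum] at h0
  obtain ⟨j, -, hj⟩ := Finset.exists_lt_of_sum_lt (f := fun _ => (0 : ℝ)) (by simpa using h0)
  have hwj : 0 < w j := (hw j).lt_of_ne (by rintro h; simp [← h] at hj)
  refine ⟨j, hwj, fun x hx => ?_⟩
  have hjB := pos_of_mul_pos_right hj (hw j)
  -- Positivity at $B$ alone means $D_{b_j}G/G<1$ there; monotonicity carries this to the rest of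
  -- the ray.
  have hanti := LowerPair.antitoneOn_div (convex_Ici 0) (hG.lowerPair he (hb j) (B • e))
    (fun s hs => by
      rw [eval_lineRestrict_ray]
      exact hGpos _ (by linarith [Set.mem_Ici.1 hs]))
    (Set.mem_Ici.2 le_rfl) (Set.mem_Ici.2 (sub_nonneg.2 hx)) (sub_nonneg.2 hx)
  simp only [eval_lineRestrict_ray, add_sub_cancel, add_zero] at hanti
  rw [sub_pos] at hjB
  rw [map_sub, sub_pos]
  rw [← div_lt_one (hGpos _ le_rfl)] at hjB
  rw [← div_lt_one (hGpos _ hx)]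
  exact hanti.trans_lt hjB

theorem exists_aboveZeros_subDirDerivs {p : MvPolynomial σ ℝ} (hp : Stable p) {e : σ → ℝ}
    (hfar : ∀ a, 0 ≤ a → ∀ᶠ t : ℝ in atTop,
      AboveZeros p (t • e) ∧ barrier a p (t • e) ≤ 1 / 2)
    {l : List (σ → ℝ)} (hl : ∀ a ∈ l, 0 ≤ a ∧ ∃ c : ℝ, a ≤ c • e) :
    ∃ t : ℝ, AboveZeros (subDirDerivs l p) (t • e) := by
  have hev : ∀ᶠ t : ℝ in atTop, AboveZeros p (t • e) ∧ ∀ a ∈ l, barrier a p (t • e) ≤ 1 / 2 := by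
    refine ((hfar 0 le_rfl).mono fun t ht => ht.1).and ?_
    exact (eventually_all_finite (List.finite_toSet l)).2 fun a ha =>
      (hfar a (hl a ha).1).mono fun t ht => ht.2
  obtain ⟨t, ht, hb⟩ := hev.exists
  -- Far out the barriers are at most $1/2=1-1/\delta$ with $\delta=2$; no sharp constant is needed.
  have h1 := ht.subDirDerivs_of_barrier_le hp (fun a ha => (hl a ha).1) (δ := 2) two_pos
    (fun a ha => (hb a ha).trans (by norm_num))
  have hsum : ∃ c : ℝ, l.sum ≤ c • e := by
    clear hev hb h1
    induction l with
    | nil => exact ⟨0, by simp⟩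
    | cons a l ih =>
      obtain ⟨c, hc⟩ := ih fun b hb => hl b (List.mem_cons_of_mem _ hb)
      obtain ⟨c', hc'⟩ := (hl a List.mem_cons_self).2
      exact ⟨c' + c, by rw [List.sum_cons, add_smul]; exact add_le_add hc' hc⟩
  obtain ⟨c, hc⟩ := hsum
  refine ⟨t + 2 * c, h1.mono ?_⟩
  rw [add_smul, mul_smul]
  exact add_le_add le_rfl (smul_le_smul_of_nonneg_left hc zero_le_two)

/-- The method of interlacing families: a choice that is no worse than the average. -/
theorem exists_choice_pos_on_ray {p : MvPolynomial σ ℝ} (hp : Stable p) {e : σ → ℝ}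
    (he : 0 ≤ e) (hfar : ∀ a, 0 ≤ a → ∀ᶠ t : ℝ in atTop,
      AboveZeros p (t • e) ∧ barrier a p (t • e) ≤ 1 / 2)
    {ι : Type*} {κ : ι → Type*} [∀ i, Fintype (κ i)] [∀ i, Nonempty (κ i)]
    (b : ∀ i, κ i → σ → ℝ) (hb : ∀ i j, 0 ≤ b i j)
    (w : ∀ i, κ i → ℝ) (hw : ∀ i j, 0 ≤ w i j) (hw1 : ∀ i, ∑ j, w i j = 1)
    (hbe : ∀ i j, 0 < w i j → ∃ c : ℝ, b i j ≤ c • e)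
    {B : ℝ} (L : List ι) (hL : L.Nodup) (l : List (σ → ℝ))
    (hl : ∀ a ∈ l, 0 ≤ a ∧ ∃ c : ℝ, a ≤ c • e)
    (hpos : ∀ x, B ≤ x → 0 < MvPolynomial.eval (x • e)
      (subDirDerivs (l ++ L.map fun i => ∑ j, w i j • b i j) p)) :
    ∃ c : ∀ i, κ i, (∀ i ∈ L, 0 < w i (c i)) ∧ ∀ x, B ≤ x → 0 < MvPolynomial.eval (x • e)
      (subDirDerivs (l ++ L.map fun i => b i (c i)) p) := by
  classical
  induction L generalizing l with
  | nil => exact ⟨fun i => Classical.arbitrary _, by simp, by simpa using hpos⟩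
  | cons i L ih =>
    have havg : ∀ i, 0 ≤ ∑ j, w i j • b i j ∧ ∃ c : ℝ, ∑ j, w i j • b i j ≤ c • e := by
      intro i
      refine ⟨Finset.sum_nonneg fun j _ => smul_nonneg (hw i j) (hb i j), ?_⟩
      have : ∀ j, ∃ c : ℝ, w i j • b i j ≤ c • e := by
        intro j
        rcases (hw i j).eq_or_lt with h | h
        · exact ⟨0, by simp [← h]⟩
        · obtain ⟨c, hc⟩ := hbe i j h
          exact ⟨w i j * c, by rw [mul_smul]; exact smul_le_smul_of_nonneg_left hc h.le⟩
      choose c hc using this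
      exact ⟨∑ j, c j, by rw [Finset.sum_smul]; exact Finset.sum_le_sum fun j _ => hc j⟩
    -- `l` holds the directions already chosen and `L` the indices still averaged; the operators
    -- commute, so that of the current index can be applied last.
    set rest := l ++ L.map fun i => ∑ j, w i j • b i j with hrest
    have hgood : ∀ a ∈ rest, 0 ≤ a ∧ ∃ c : ℝ, a ≤ c • e := by
      intro a ha
      rcases List.mem_append.1 ha with ha | ha
      · exact hl a ha
      · obtain ⟨i', -, rfl⟩ := List.mem_map.1 ha
        exact havg i'
    obtain ⟨t, ht⟩ := exists_aboveZeros_subDirDerivs hp hfar hgood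
    obtain ⟨j, hj, hjpos⟩ := (hp.subDirDerivs fun a ha => (hgood a ha).1).exists_sub_dirDeriv_pos_on_ray
      he ht (b i) (hb i) (w i) (hw i) (hw1 i) (B := B) (fun x hx => by
        have := hpos x hx
        rwa [List.map_cons, subDirDerivs_perm List.perm_middle, subDirDerivs_cons] at this)
    obtain ⟨hiL, hL'⟩ := List.nodup_cons.1 hL
    obtain ⟨c, hc, hcpos⟩ := ih hL' (b i j :: l)
      (fun a ha => by
        rcases List.mem_cons.1 ha with rfl | ha
        · exact ⟨hb i j, hbe i j hj⟩
        · exact hl a ha)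
      (fun x hx => hjpos x hx)
    have hne : ∀ i' ∈ L, Function.update c i j i' = c i' := fun i' hi' =>
      Function.update_of_ne (by rintro rfl; exact hiL hi') _ _
    refine ⟨Function.update c i j, fun i' hi' => ?_, fun x hx => ?_⟩
    · rcases List.mem_cons.1 hi' with rfl | hi'
      · simpa using hj
      · rw [hne i' hi']
        exact hc i' hi'
    · have h1 : (L.map fun i' => b i' (Function.update c i j i')) = L.map fun i' => b i' (c i') :=
        List.map_congr_left fun i' hi' => by rw [hne i' hi']
      rw [List.map_cons, Function.update_self, h1, subDirDerivs_perm List.perm_middle]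
      exact hcpos x hx

end Selection

/-! ### Translation by $1-D_a$ on polynomials affine along $a$. -/

section Multiaffine

variable {σ : Type*}

theorem eval_sub_dirDeriv_of_affine {q : MvPolynomial σ ℝ} {a : σ → ℝ}
    (h : dirDeriv a (dirDeriv a q) = 0) (z : σ → ℝ) :
    MvPolynomial.eval z (q - dirDeriv a q) = MvPolynomial.eval (z - a) q := by
  have h2 : Polynomial.derivative (Polynomial.derivative (lineRestrict z a q)) = 0 := by
    simp [derivative_lineRestrict, h]
  obtain ⟨c, hc⟩ : ∃ c, Polynomial.derivative (lineRestrict z a q) = Polynomial.C c :=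
    ⟨_, Polynomial.eq_C_of_derivative_eq_zero h2⟩
  obtain ⟨c', hc'⟩ : ∃ c', lineRestrict z a q - Polynomial.C c * Polynomial.X = Polynomial.C c' :=
    ⟨_, Polynomial.eq_C_of_derivative_eq_zero (by simp [hc])⟩
  have h0 : ∀ s, (lineRestrict z a q).eval s = c' + c * s := by
    intro s
    rw [sub_eq_iff_eq_add.1 hc']
    simp
  have h3 := h0 0
  have h4 := h0 (-1)
  have h5 : (Polynomial.derivative (lineRestrict z a q)).eval 0 = c := by simp [hc]
  rw [derivative_lineRestrict, lineRestrict_eval_zero] at h5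
  rw [lineRestrict_eval_zero] at h3
  rw [eval_lineRestrict_real, neg_smul, one_smul, ← sub_eq_add_neg] at h4
  rw [map_sub, h3, h4, h5]
  ring

theorem eval_subDirDerivs_of_affine {p : MvPolynomial σ ℝ} {l : List (σ → ℝ)}
    (h : ∀ a ∈ l, dirDeriv a (dirDeriv a p) = 0) (z : σ → ℝ) :
    MvPolynomial.eval z (subDirDerivs l p) = MvPolynomial.eval (z - l.sum) p := by
  induction l generalizing z with
  | nil => simp [subDirDerivs]
  | cons a l ih =>
    rw [subDirDerivs_cons, eval_sub_dirDeriv_of_affine, ih fun b hb =>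
      h b (List.mem_cons_of_mem _ hb), List.sum_cons, sub_sub]
    rw [dirDeriv_subDirDerivs, dirDeriv_subDirDerivs, h a List.mem_cons_self, subDirDerivs_zero]

end Multiaffine

/-! ### The determinantal polynomial: stability, barrier, rank-one directions. -/

section Determinant

open Filter Topology
open scoped ComplexConjugate ComplexOrder

/-- By the Schur complement this is a bordered determinant in which $s$ occurs only in the last row.
-/
theorem Matrix.exists_det_add_smul_vecMulVec {n R : Type*} [Fintype n] [DecidableEq n] [CommRing R]
    (M : Matrix n n R) (u v : n → R) :
    ∃ c : R, ∀ s : R, (M + s • Matrix.vecMulVec u v).det = M.det + s * c := by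
  set N : Matrix (n ⊕ Unit) (n ⊕ Unit) R :=
    Matrix.fromBlocks M (-Matrix.replicateCol Unit u) 0 1 with hN
  have hdet : ∀ s : R, (M + s • Matrix.vecMulVec u v).det =
      (Matrix.fromBlocks M (-Matrix.replicateCol Unit u) (s • Matrix.replicateRow Unit v) 1).det := by
    intro s
    rw [Matrix.det_fromBlocks_one₂₂]
    congr 1
    ext i j
    simp [Matrix.vecMulVec_apply, Matrix.mul_apply]
  refine ⟨(N.updateRow (Sum.inr ()) (Sum.elim v 0)).det, fun s => ?_⟩
  have hrow : Matrix.fromBlocks M (-Matrix.replicateCol Unit u) (s • Matrix.replicateRow Unit v) 1 =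
      N.updateRow (Sum.inr ()) (N (Sum.inr ()) + s • Sum.elim v 0) := by
    ext i j
    rcases i with i | i <;> rcases j with j | j <;> simp [hN, Matrix.updateRow_apply]
  have h0 := hdet 0
  rw [zero_smul, zero_smul, add_zero] at h0
  rw [hdet s, hrow, Matrix.det_updateRow_add, Matrix.det_updateRow_smul, Matrix.updateRow_eq_self,
    h0]

theorem posSemidef_selfOuter {d : ℕ} (v : EuclideanSpace ℂ (Fin d)) : (selfOuter v).PosSemidef :=
  Matrix.posSemidef_vecMulVec_self_star _

theorem trace_selfOuter {d : ℕ} (v : EuclideanSpace ℂ (Fin d)) :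
    (selfOuter v).trace = ((‖v‖ ^ 2 : ℝ) : ℂ) := by
  rw [selfOuter, Matrix.trace_vecMulVec, EuclideanSpace.norm_sq_eq]
  simp [dotProduct, Complex.mul_conj, Complex.normSq_eq_norm_sq]

variable {σ : Type*} [Fintype σ] {d : ℕ}

/-- Conjugating coefficients transposes a Hermitian pencil, so its determinant has real
coefficients. -/
theorem exists_mvPolynomial_aeval_eq_det (W : σ → Matrix (Fin d) (Fin d) ℂ)
    (hW : ∀ k, (W k).IsHermitian) :
    ∃ p : MvPolynomial σ ℝ, ∀ z : σ → ℂ, MvPolynomial.aeval z p = (∑ k, z k • W k).det := by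
  set M : Matrix (Fin d) (Fin d) (MvPolynomial σ ℂ) :=
    ∑ k, (MvPolynomial.X k : MvPolynomial σ ℂ) • (W k).map MvPolynomial.C with hM
  have hconj : MvPolynomial.map (starRingEnd ℂ) M.det = M.det := by
    rw [RingHom.map_det, ← Matrix.det_transpose M]
    congr 1
    ext i j : 1
    simp only [hM, RingHom.mapMatrix_apply, Matrix.map_apply, Matrix.transpose_apply,
      Matrix.sum_apply, Matrix.smul_apply, smul_eq_mul, map_sum, map_mul, MvPolynomial.map_X,
      MvPolynomial.map_C]
    refine Finset.sum_congr rfl fun k _ => ?_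
    rw [← (hW k).apply j i]
    rfl
  obtain ⟨p, hp⟩ : M.det ∈ Set.range (MvPolynomial.map (algebraMap ℝ ℂ)) := by
    rw [MvPolynomial.mem_range_map_iff_coeffs_subset]
    intro c hc
    obtain ⟨n, -, rfl⟩ := MvPolynomial.mem_coeffs_iff.1 hc
    have := congrArg (MvPolynomial.coeff n) hconj
    rw [MvPolynomial.coeff_map] at this
    obtain ⟨r, hr⟩ := Complex.conj_eq_iff_real.1 this
    exact ⟨r, hr.symm⟩
  refine ⟨p, fun z => ?_⟩
  have h1 : MvPolynomial.aeval z p = MvPolynomial.eval z M.det := by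
    rw [← hp, MvPolynomial.eval_map, MvPolynomial.aeval_def]
  rw [h1, RingHom.map_det]
  congr 1
  ext i j : 1
  simp [hM, Matrix.sum_apply]

section DetPoly

variable {w : σ → EuclideanSpace ℂ (Fin d)} {p : MvPolynomial σ ℝ} {e : σ → ℝ}

theorem ofReal_eval_eq_det
    (hp : ∀ z : σ → ℂ, MvPolynomial.aeval z p = (∑ k, z k • selfOuter (w k)).det) (x : σ → ℝ) :
    ((MvPolynomial.eval x p : ℝ) : ℂ) = (∑ k, (x k : ℂ) • selfOuter (w k)).det := by
  rw [← hp]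
  have := MvPolynomial.aeval_algebraMap_apply ℂ x p
  rw [MvPolynomial.aeval_eq_eval] at this
  exact this.symm

/-- For a kernel vector $v$, the imaginary part of the quadratic form is $\sum_k
\mathrm{Im}(z_k)\,v^*w_kw_k^*v=0$. All these forms then vanish, and weighting them by $e$ gives
$v^*v=0$. -/
theorem stable_of_aeval_eq_det
    (hp : ∀ z : σ → ℂ, MvPolynomial.aeval z p = (∑ k, z k • selfOuter (w k)).det)
    (hsum : ∑ k, (e k : ℂ) • selfOuter (w k) = 1) : Stable p := by
  intro z hz h0
  rw [hp] at h0
  obtain ⟨v, hv, hMv⟩ := Matrix.exists_mulVec_eq_zero_iff.2 h0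
  have hq : ∀ k, ∃ r : ℝ, 0 ≤ r ∧ star v ⬝ᵥ (selfOuter (w k)).mulVec v = r := by
    intro k
    have := (posSemidef_selfOuter (w k)).dotProduct_mulVec_nonneg v
    exact ⟨_, (Complex.nonneg_iff.1 this).1, Complex.ext rfl (by simpa using (Complex.nonneg_iff.1 this).2.symm)⟩
  choose r hr hrv using hq
  have hform : ∀ y : σ → ℂ, star v ⬝ᵥ (∑ k, y k • selfOuter (w k)).mulVec v = ∑ k, y k * r k := by
    intro y
    rw [Matrix.sum_mulVec, dotProduct_sum]
    refine Finset.sum_congr rfl fun k _ => ?_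
    rw [Matrix.smul_mulVec, dotProduct_smul, hrv, smul_eq_mul]
  have h1 := hform z
  rw [hMv, dotProduct_zero] at h1
  have h2 := congrArg Complex.im h1
  simp only [Complex.zero_im, Complex.im_sum, Complex.im_mul_ofReal] at h2
  have h3 := (Finset.sum_eq_zero_iff_of_nonneg
    fun k _ => mul_nonneg (hz k).le (hr k)).1 h2.symm
  have h4 : ∀ k, r k = 0 := fun k =>
    (mul_eq_zero.1 (h3 k (Finset.mem_univ k))).resolve_left (hz k).ne'
  have h5 := hform fun k => (e k : ℂ)
  rw [hsum, Matrix.one_mulVec] at h5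
  simp only [h4, Complex.ofReal_zero, mul_zero, Finset.sum_const_zero] at h5
  exact hv (dotProduct_star_self_eq_zero.1 h5)

theorem aboveZeros_of_aeval_eq_det
    (hp : ∀ z : σ → ℂ, MvPolynomial.aeval z p = (∑ k, z k • selfOuter (w k)).det)
    (hsum : ∑ k, (e k : ℂ) • selfOuter (w k) = 1) {t : ℝ} (ht : 0 < t) :
    AboveZeros p (t • e) := by
  intro y hy
  have hdec : ∑ k, (y k : ℂ) • selfOuter (w k) = (t : ℂ) • (1 : Matrix (Fin d) (Fin d) ℂ) +
      ∑ k, ((y k - t * e k : ℝ) : ℂ) • selfOuter (w k) := by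
    rw [← hsum, Finset.smul_sum, ← Finset.sum_add_distrib]
    refine Finset.sum_congr rfl fun k _ => ?_
    rw [smul_smul, ← add_smul]
    congr 1
    push_cast
    ring
  have hpd : (∑ k, (y k : ℂ) • selfOuter (w k)).PosDef := by
    rw [hdec]
    refine (Matrix.PosDef.one.smul (by exact_mod_cast ht)).add_posSemidef
      (Matrix.posSemidef_sum _ fun k _ => (posSemidef_selfOuter (w k)).smul ?_)
    have := hy k
    simp only [Pi.smul_apply, smul_eq_mul] at this
    exact_mod_cast sub_nonneg.2 this
  have := hpd.det_pos
  rw [← ofReal_eval_eq_det hp] at this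
  exact_mod_cast this

/-- The restriction is $t^d\det(1+(s/t)A)$, and the derivative of the determinant at the identity is
the trace. -/
theorem barrier_of_aeval_eq_det
    (hp : ∀ z : σ → ℂ, MvPolynomial.aeval z p = (∑ k, z k • selfOuter (w k)).det)
    (hsum : ∑ k, (e k : ℂ) • selfOuter (w k) = 1) {t : ℝ} (ht : 0 < t) (a : σ → ℝ) :
    barrier a p (t • e) = (∑ k, a k * ‖w k‖ ^ 2) / t := by
  set A : Matrix (Fin d) (Fin d) ℂ := ∑ k, (a k : ℂ) • selfOuter (w k) with hA
  have htc : (t : ℂ) ≠ 0 := by exact_mod_cast ht.ne'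
  have hS : (lineRestrict (t • e) a p).map (algebraMap ℝ ℂ) =
      Polynomial.C ((t : ℂ) ^ d) *
        (1 + (Polynomial.X : Polynomial ℂ) • A.map Polynomial.C).det.comp
          (Polynomial.C (t : ℂ)⁻¹ * Polynomial.X) := by
    refine Polynomial.funext fun s => ?_
    rw [Polynomial.eval_map_algebraMap, aeval_lineRestrict_real, hp]
    have h1 : ∑ k, (((t • e) k : ℝ) + (a k : ℂ) * s) • selfOuter (w k) =
        (t : ℂ) • (1 + ((t : ℂ)⁻¹ * s) • A) := by
      rw [← hsum, hA, smul_add, smul_smul, ← mul_assoc, mul_inv_cancel₀ htc, one_mul,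
        Finset.smul_sum, Finset.smul_sum, ← Finset.sum_add_distrib]
      refine Finset.sum_congr rfl fun k _ => ?_
      rw [smul_smul, smul_smul, ← add_smul]
      congr 1
      simp
      ring
    rw [h1, Matrix.det_smul, Fintype.card_fin]
    simp only [Polynomial.eval_mul, Polynomial.eval_C, Polynomial.eval_comp, Polynomial.eval_X]
    congr 1
    rw [← Polynomial.coe_evalRingHom, RingHom.map_det]
    congr 1
    ext i j
    simp [Matrix.one_apply]
    split_ifs <;> simp [mul_comm]
  have hS0 : (((lineRestrict (t • e) a p).eval 0 : ℝ) : ℂ) = (t : ℂ) ^ d := by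
    have := congrArg (Polynomial.eval 0) hS
    rw [Polynomial.eval_map_algebraMap, ← Complex.ofReal_zero, aeval_ofReal_eq] at this
    rw [this]
    simp [Polynomial.eval_comp, _root_.eval_det_add_X_smul]
  have hS1 : (((lineRestrict (t • e) a p).derivative.eval 0 : ℝ) : ℂ) =
      (t : ℂ) ^ d * ((t : ℂ)⁻¹ * A.trace) := by
    have := congrArg (fun S => Polynomial.eval 0 (Polynomial.derivative S)) hS
    simp only [Polynomial.derivative_map] at this
    rw [Polynomial.eval_map_algebraMap, ← Complex.ofReal_zero, aeval_ofReal_eq] at this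
    rw [this, Polynomial.derivative_C_mul]
    simp [Polynomial.derivative_comp, Polynomial.eval_comp, Matrix.derivative_det_one_add_X_smul]
  have htr : A.trace = ((∑ k, a k * ‖w k‖ ^ 2 : ℝ) : ℂ) := by
    rw [hA, Matrix.trace_sum]
    push_cast
    refine Finset.sum_congr rfl fun k _ => ?_
    rw [Matrix.trace_smul, trace_selfOuter]
    simp
  rw [barrier_eq_derivative_div]
  apply Complex.ofReal_injective
  rw [Complex.ofReal_div, hS0, hS1, htr]
  push_cast
  field_simp

theorem dirDeriv_single_sq_of_aeval_eq_det [DecidableEq σ]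
    (hp : ∀ z : σ → ℂ, MvPolynomial.aeval z p = (∑ k, z k • selfOuter (w k)).det) (k : σ) :
    dirDeriv (Pi.single k 1) (dirDeriv (Pi.single k 1) p) = 0 := by
  refine MvPolynomial.funext fun x => ?_
  obtain ⟨c, hc⟩ := Matrix.exists_det_add_smul_vecMulVec (∑ k, (x k : ℂ) • selfOuter (w k))
    (w k).ofLp (star (w k).ofLp)
  have hS : (lineRestrict x (Pi.single k 1) p).map (algebraMap ℝ ℂ) =
      Polynomial.C (∑ k, (x k : ℂ) • selfOuter (w k)).det + Polynomial.X * Polynomial.C c := by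
    refine Polynomial.funext fun s => ?_
    rw [Polynomial.eval_map_algebraMap, aeval_lineRestrict_real, hp]
    simp only [Polynomial.eval_add, Polynomial.eval_mul, Polynomial.eval_C, Polynomial.eval_X]
    rw [← hc s]
    congr 1
    simp only [add_smul, Finset.sum_add_distrib]
    congr 1
    rw [Finset.sum_eq_single k]
    · simp [selfOuter]
    · intro j _ hj
      simp [hj]
    · simp
  have hS2 : Polynomial.derivative (Polynomial.derivative (lineRestrict x (Pi.single k 1) p)) = 0 := by
    rw [← Polynomial.map_eq_zero (algebraMap ℝ ℂ), ← Polynomial.derivative_map,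
      ← Polynomial.derivative_map, hS]
    simp
  rw [derivative_lineRestrict, derivative_lineRestrict] at hS2
  rw [map_zero, ← lineRestrict_eval_zero x (Pi.single k 1), hS2, Polynomial.eval_zero]

end DetPoly

/-- The norm of a positive semidefinite matrix belongs to its spectrum; $d=0$ is separate because
the spectrum is then empty. -/
theorem norm_le_of_det_ne_zero {H : Matrix (Fin d) (Fin d) ℂ} (hH : H.PosSemidef) {B : ℝ}
    (hB : 0 ≤ B) (h : ∀ x : ℝ, B ≤ x → ((x : ℂ) • (1 : Matrix (Fin d) (Fin d) ℂ) - H).det ≠ 0) :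
    ‖H‖ ≤ B := by
  open scoped MatrixOrder in
  rcases subsingleton_or_nontrivial (Matrix (Fin d) (Fin d) ℂ) with hs | hn
  · rw [Subsingleton.elim H 0, norm_zero]
    exact hB
  · by_contra! hlt
    have hmem := CStarAlgebra.norm_mem_spectrum_of_nonneg (a := H) hH.nonneg
    rw [spectrum.mem_iff, Matrix.isUnit_iff_isUnit_det, isUnit_iff_ne_zero, not_not] at hmem
    refine h ‖H‖ hlt.le ?_
    rw [← hmem]
    congr 2
    ext i j
    simp [Matrix.algebraMap_matrix_apply, Matrix.one_apply]

end Determinant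

/-! ### The deterministic selection theorem and the choice of constants. -/

section FiniteChoice

open Filter Topology
open scoped ComplexOrder

/-- Each term of the expanded cube is a word of length three in at most two commuting letters, so
some letter occurs twice and kills $p$. -/
theorem dirDeriv_cube_sum_eq_zero {σ κ : Type*} [Fintype κ] (hκ : Fintype.card κ ≤ 2)
    {p : MvPolynomial σ ℝ} (b : κ → σ → ℝ) (hb : ∀ j, dirDeriv (b j) (dirDeriv (b j) p) = 0)
    (q : κ → ℝ) :
    dirDeriv (∑ j, q j • b j) (dirDeriv (∑ j, q j • b j) (dirDeriv (∑ j, q j • b j) p)) = 0 := by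
  have hD : ∀ f, dirDeriv (∑ j, q j • b j) f = ∑ j, q j • dirDeriv (b j) f := by
    intro f
    rw [dirDeriv_sum]
    simp [dirDeriv_smul]
  simp only [hD, map_sum, Derivation.map_smul]
  refine Finset.sum_eq_zero fun i _ => ?_
  rw [Finset.sum_eq_zero, smul_zero]
  intro j _
  rw [Finset.sum_eq_zero, smul_zero]
  intro k _
  have h : dirDeriv (b i) (dirDeriv (b j) (dirDeriv (b k) p)) = 0 := by
    by_cases hij : i = j
    · rw [hij, dirDeriv_comm (b j) (b k), dirDeriv_comm (b j) (b k), hb, map_zero]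
    by_cases hik : i = k
    · rw [hik, dirDeriv_comm (b j) (b k), dirDeriv_comm (b k) (b k), dirDeriv_comm (b k) (b j),
        dirDeriv_comm (b k) (b j), hb, map_zero]
    by_cases hjk : j = k
    · rw [hjk, hb, map_zero]
    exact absurd (Fintype.two_lt_card_iff.2 ⟨i, j, k, hij, hik, hjk⟩) (not_lt.2 hκ)
  rw [h, smul_zero]

variable {m d : ℕ} {κ : Fin m → Type*} [∀ i, Fintype (κ i)]

theorem exists_choice_norm_le [∀ i, Nonempty (κ i)] (w : ∀ i, κ i → EuclideanSpace ℂ (Fin d))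
    (q : ∀ i, κ i → ℝ) (hq : ∀ i j, 0 ≤ q i j) (hq1 : ∀ i, ∑ j, q i j = 1)
    (hsum : ∑ i, ∑ j, (q i j : ℂ) • selfOuter (w i j) = 1) {ε : ℝ} (hε : 0 < ε)
    (hnorm : ∀ i, ∑ j, q i j * ‖w i j‖ ^ 2 ≤ ε) :
    (∃ c : ∀ i, κ i, (∀ i, 0 < q i (c i)) ∧
      ‖∑ i, selfOuter (w i (c i))‖ ≤ (1 + √ε) ^ 2) ∧
    ((∀ i, Fintype.card (κ i) ≤ 2) → ε < 1 / 4 →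
      ∃ c : ∀ i, κ i, (∀ i, 0 < q i (c i)) ∧
        ‖∑ i, selfOuter (w i (c i))‖ ≤ 1 + 2 * √ε * √(1 - ε)) := by
  classical
  set W : (Σ i, κ i) → EuclideanSpace ℂ (Fin d) := fun k => w k.1 k.2 with hW
  set e : (Σ i, κ i) → ℝ := fun k => q k.1 k.2 with he_def
  set b : ∀ i, κ i → (Σ i, κ i) → ℝ := fun i j => Pi.single ⟨i, j⟩ 1 with hb_def
  set avg : Fin m → (Σ i, κ i) → ℝ := fun i => ∑ j, q i j • b i j with havg_def
  set L := (List.finRange m).map avg with hL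
  have he : 0 ≤ e := fun k => hq k.1 k.2
  have hb : ∀ i j, 0 ≤ b i j := fun i j => Pi.single_nonneg.2 zero_le_one
  have havg : ∀ i, 0 ≤ avg i := fun i =>
    Finset.sum_nonneg fun j _ => smul_nonneg (hq i j) (hb i j)
  have hLnn : ∀ a ∈ L, 0 ≤ a := by
    intro a ha
    obtain ⟨i, -, rfl⟩ := List.mem_map.1 ha
    exact havg i
  -- The shifts add up to a multiple of $e$, so the barrier argument ends on the ray it started
  -- from.
  have hLsum : L.sum = e := by
    rw [hL, ← Fin.sum_univ_def]
    have h1 : ∑ i, avg i = ∑ k : Σ i, κ i, e k • Pi.single k (1 : ℝ) := by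
      rw [Fintype.sum_sigma]
    rw [h1]
    ext k
    simp [Finset.sum_apply, Pi.single_apply]
  have hsum' : ∑ k, (e k : ℂ) • selfOuter (W k) = 1 := by
    rw [Fintype.sum_sigma]
    exact hsum
  obtain ⟨p, hp⟩ := exists_mvPolynomial_aeval_eq_det (fun k => selfOuter (W k))
    fun k => (posSemidef_selfOuter (W k)).isHermitian
  have hstable := stable_of_aeval_eq_det hp hsum'
  have hsq : ∀ i j, dirDeriv (b i j) (dirDeriv (b i j) p) = 0 := fun i j =>
    dirDeriv_single_sq_of_aeval_eq_det hp ⟨i, j⟩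
  have hbar : ∀ t : ℝ, 0 < t → ∀ a ∈ L, barrier a p (t • e) ≤ ε / t := by
    intro t ht a ha
    obtain ⟨i, -, rfl⟩ := List.mem_map.1 ha
    rw [barrier_of_aeval_eq_det hp hsum' ht]
    refine div_le_div_of_nonneg_right (le_trans (le_of_eq ?_) (hnorm i)) ht.le
    simp only [havg_def, hb_def, Finset.sum_apply, Pi.smul_apply, Finset.sum_mul, smul_eq_mul]
    rw [Finset.sum_comm]
    refine Finset.sum_congr rfl fun j _ => ?_
    rw [Finset.sum_eq_single ⟨i, j⟩] <;> simp +contextual [hW]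
  have hfar : ∀ a, 0 ≤ a → ∀ᶠ t : ℝ in atTop,
      AboveZeros p (t • e) ∧ barrier a p (t • e) ≤ 1 / 2 := by
    intro a _
    filter_upwards [eventually_gt_atTop 0,
      eventually_ge_atTop (2 * ∑ k, a k * ‖W k‖ ^ 2)] with t ht ht2
    refine ⟨aboveZeros_of_aeval_eq_det hp hsum' ht, ?_⟩
    rw [barrier_of_aeval_eq_det hp hsum' ht, div_le_iff₀ ht]
    linarith
  have hbe : ∀ i j, 0 < q i j → ∃ c : ℝ, b i j ≤ c • e := by
    intro i j hij
    refine ⟨(q i j)⁻¹, fun k => ?_⟩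
    by_cases hk : k = ⟨i, j⟩
    · subst hk
      simp [hb_def, he_def, inv_mul_cancel₀ hij.ne']
    · simp only [hb_def, Pi.single_eq_of_ne hk, Pi.smul_apply, smul_eq_mul]
      exact mul_nonneg (inv_nonneg.2 hij.le) (he k)
  have core : ∀ B : ℝ, 0 ≤ B → AboveZeros (subDirDerivs L p) (B • e) →
      ∃ c : ∀ i, κ i, (∀ i, 0 < q i (c i)) ∧ ‖∑ i, selfOuter (w i (c i))‖ ≤ B := by
    intro B hB hab
    obtain ⟨c, hc, hcpos⟩ := exists_choice_pos_on_ray hstable he hfar b hb q hq hq1 hbe (B := B)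
      (List.finRange m) (List.nodup_finRange m) [] (by simp)
      (fun x hx => hab _ (smul_le_smul_of_nonneg_right hx he))
    refine ⟨c, fun i => hc i (List.mem_finRange i), ?_⟩
    refine norm_le_of_det_ne_zero
      (Matrix.posSemidef_sum _ fun i _ => posSemidef_selfOuter _) hB fun x hx => ?_
    have h1 := hcpos x hx
    rw [List.nil_append, eval_subDirDerivs_of_affine, ← Fin.sum_univ_def] at h1
    · have h2 := ofReal_eval_eq_det hp (x • e - ∑ i, b i (c i))
      have h3 : ∑ k, (((x • e - ∑ i, b i (c i)) k : ℝ) : ℂ) • selfOuter (W k) =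
          (x : ℂ) • (1 : Matrix (Fin d) (Fin d) ℂ) - ∑ i, selfOuter (w i (c i)) := by
        rw [← hsum', Finset.smul_sum]
        have h4 : ∑ i, selfOuter (w i (c i)) =
            ∑ k, ((∑ i, b i (c i)) k : ℂ) • selfOuter (W k) := by
          simp only [Finset.sum_apply, Complex.ofReal_sum, Finset.sum_smul]
          rw [Finset.sum_comm]
          refine Finset.sum_congr rfl fun i _ => ?_
          rw [Finset.sum_eq_single ⟨i, c i⟩] <;> simp +contextual [hW, hb_def]
        rw [h4, ← Finset.sum_sub_distrib]
        refine Finset.sum_congr rfl fun k _ => ?_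
        rw [smul_smul, ← sub_smul]
        simp
      rw [← h3, ← h2]
      exact_mod_cast h1.ne'
    · intro a ha
      obtain ⟨i, -, rfl⟩ := List.mem_map.1 ha
      exact hsq i (c i)
  have hs0 : 0 < √ε := Real.sqrt_pos.2 hε
  have hs2 : √ε ^ 2 = ε := Real.sq_sqrt hε.le
  refine ⟨core _ (by positivity) ?_, fun hcard hε4 => core _ (by positivity) ?_⟩
  -- $t=\sqrt\epsilon+\epsilon$ and $\delta=1+\sqrt\epsilon$ satisfy $\epsilon/t=1-1/\delta$ and
  -- $t+\delta=(1+\sqrt\epsilon)^2$.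
  · have ht : 0 < √ε + ε := by positivity
    have h1 := (aboveZeros_of_aeval_eq_det hp hsum' ht).subDirDerivs_of_barrier_le hstable hLnn
      (δ := 1 + √ε) (by positivity) (fun a ha => (hbar _ ht a ha).trans (le_of_eq (by
        rw [← hs2, Real.sqrt_sq hs0.le]
        field_simp
        ring)))
    rw [hLsum, ← add_smul] at h1
    convert h1 using 2
    rw [← hs2, Real.sqrt_sq hs0.le]
    ring
  · have hr0 : 0 < √(1 - ε) := Real.sqrt_pos.2 (by linarith)
    have hr2 : √(1 - ε) ^ 2 = 1 - ε := Real.sq_sqrt (by linarith)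
    set α := √ε
    set β := √(1 - ε)
    have hαβ : α ^ 2 + β ^ 2 = 1 := by rw [hs2, hr2]; ring
    have hlt : α < β := Real.sqrt_lt_sqrt hε.le (by linarith)
    have hdiff : 0 < β ^ 2 - α ^ 2 := by nlinarith
    -- With $\eta=\alpha/\beta$, this $t$ solves $\epsilon/t=\eta/(1-\eta^2)$, and
    -- $t+1+\eta=1+2\alpha\beta$ because $\alpha^2+\beta^2=1$.
    have ht : 0 < α * (β ^ 2 - α ^ 2) / β := by positivity
    have h1 := (aboveZeros_of_aeval_eq_det hp hsum' ht).subDirDerivs_of_quadratic hstable hLnn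
      (fun a ha => by
        obtain ⟨i, -, rfl⟩ := List.mem_map.1 ha
        exact dirDeriv_cube_sum_eq_zero (hcard i) (b i) (hsq i) (q i))
      (η := α / β) (by positivity) ((div_lt_one hr0).2 hlt)
      (fun a ha => (hbar _ ht a ha).trans (le_of_eq (by
        rw [← hs2]
        have : 1 - (α / β) ^ 2 = (β ^ 2 - α ^ 2) / β ^ 2 := by field_simp
        rw [this]
        field_simp)))
    rw [hLsum, ← add_smul] at h1
    convert h1 using 2
    have hβ : β ^ 2 = 1 - α ^ 2 := by linarith
    field_simp
    linear_combination α * hβ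

end FiniteChoice

/-! ### From a choice of positive weights to an event of positive probability. -/

section Probability

theorem integral_comp_of_finite_range {Ω E F : Type*} [MeasurableSpace Ω] (P : Measure Ω)
    [IsFiniteMeasure P] [MeasurableSpace E] [MeasurableSingletonClass E] [NormedAddCommGroup F]
    [NormedSpace ℝ F] [CompleteSpace F] {v : Ω → E} (hv : Measurable v)
    [Fintype (Set.range v)] (g : E → F) :
    ∫ ω, g (v ω) ∂P = ∑ r : Set.range v, P.real (v ⁻¹' {r.1}) • g r := by
  classical
  have h1 : ∀ ω, g (v ω) = ∑ r : Set.range v, (v ⁻¹' {r.1}).indicator (fun _ => g r) ω := by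
    intro ω
    rw [Finset.sum_eq_single ⟨v ω, ω, rfl⟩]
    · simp
    · rintro ⟨r, hr⟩ _ hne
      refine Set.indicator_of_notMem ?_ _
      rintro rfl
      exact hne rfl
    · simp
  simp_rw [h1]
  rw [integral_finsetSum]
  · refine Finset.sum_congr rfl fun r _ => ?_
    rw [integral_indicator_const _ (hv (measurableSet_singleton _))]
  · intro r _
    exact (integrable_const _).indicator (hv (measurableSet_singleton _))

/-- By independence the event that every $v_i$ takes its chosen value has probability the product of
positive atoms. -/
theorem measure_pos_of_choice {Ω ι E : Type*} [Fintype ι] [MeasurableSpace Ω] {P : Measure Ω}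
    [IsFiniteMeasure P] [MeasurableSpace E] [MeasurableSingletonClass E] {v : ι → Ω → E}
    (hindep : iIndepFun v P) (c : ι → E) (hc : ∀ i, 0 < P.real (v i ⁻¹' {c i})) {S : Set Ω}
    (hS : ∀ ω, (∀ i, v i ω = c i) → ω ∈ S) : 0 < P S := by
  have h1 := hindep.measure_inter_preimage_eq_mul Finset.univ (sets := fun i => {c i})
    fun i _ => measurableSet_singleton _
  have h2 : 0 < P (⋂ i ∈ (Finset.univ : Finset ι), v i ⁻¹' {c i}) := by
    rw [h1, pos_iff_ne_zero, Finset.prod_ne_zero_iff]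
    exact fun i _ h0 => (hc i).ne' (by rw [measureReal_def, h0, ENNReal.toReal_zero])
  refine h2.trans_le (measure_mono fun ω hω => hS ω fun i => ?_)
  simpa using Set.mem_iInter₂.1 hω i (Finset.mem_univ i)

end Probability

theorem mainTheorem3 {Ω : Type*} [MeasurableSpace Ω] (P : Measure Ω) [IsProbabilityMeasure P]
    (d m : ℕ) (ε : ℝ) (hε : 0 < ε)
    (v : Fin m → Ω → EuclideanSpace ℂ (Fin d))
    (hmeas : ∀ i, Measurable (v i))
    (hindep : iIndepFun v P)
    (hfin : ∀ i, (Set.range (v i)).Finite)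
    (hsum : ∑ i, ∫ ω, selfOuter (v i ω) ∂P = 1)
    (hnorm : ∀ i, ∫ ω, ‖v i ω‖ ^ 2 ∂P ≤ ε) :
    0 < P {ω | ‖∑ i, selfOuter (v i ω)‖ ≤ (1 + √ε) ^ 2} ∧
    ((∀ i, (Set.range (v i)).encard ≤ 2) → ε < 1 / 4 →
      0 < P {ω | ‖∑ i, selfOuter (v i ω)‖ ≤ 1 + 2 * √ε * √(1 - ε)}) := by
  have : Nonempty Ω := nonempty_of_isProbabilityMeasure P
  have hft : ∀ i, Fintype (Set.range (v i)) := fun i => (hfin i).fintype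
  have hne : ∀ i, Nonempty (Set.range (v i)) := fun i => (Set.range_nonempty (v i)).to_subtype
  obtain ⟨h1, h2⟩ := exists_choice_norm_le (κ := fun i => Set.range (v i)) (fun i r => r.1)
    (fun i r => P.real (v i ⁻¹' {r.1})) (fun i r => measureReal_nonneg)
    (fun i => by
      have := integral_comp_of_finite_range P (hmeas i) (fun _ => (1 : ℝ))
      simpa using this.symm)
    (by
      rw [← hsum]
      refine Finset.sum_congr rfl fun i _ => ?_
      rw [integral_comp_of_finite_range P (hmeas i) selfOuter]
      refine Finset.sum_congr rfl fun r _ => ?_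
      ext j k
      simp)
    hε
    (fun i => by
      have := integral_comp_of_finite_range P (hmeas i) (fun x => ‖x‖ ^ 2)
      simpa using this.symm.trans_le (hnorm i))
  refine ⟨?_, fun hcard hε4 => ?_⟩
  · obtain ⟨c, hc, hle⟩ := h1
    refine measure_pos_of_choice hindep (fun i => (c i).1) hc fun ω hω => ?_
    simpa [hω] using hle
  · obtain ⟨c, hc, hle⟩ := h2 (fun i => by
      have := hcard i
      rw [Set.encard_eq_coe_toFinset_card, Set.toFinset_card] at this
      exact_mod_cast this) hε4
    refine measure_pos_of_choice hindep (fun i => (c i).1) hc fun ω hω => ?_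
    simpa [hω] using hle
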